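/- Let $e$ be a Hermite--Biehler function, i.e. an entire function with $|e(z)|>|e(\overline z)|$ for $\operatorname{Im} z>0$, and assume that $e$ has no real zeros. Write $f^\#(z)=\overline{f(\overline z)}$, let $H_2$ be the Hardy space of the upper half-plane, and let $$\mathcal B=\{f \text{ entire}: f/e,\ f^\#/e\in H_2\},\qquad \|f\|_{\mathcal B}^2=\int_{\mathbb R}\frac{|f(x)|^2}{|e(x)|^2}\,dx$$ be the de Branges space generated by $e$. For $\beta\in[0,\pi)$ put $s_\beta(z)=\frac i2\left[e^{i\beta}e(z)-e^{-i\beta}e^\#(z)\right]$. Assume that $s_0\in\mathcal B$ and fix $\beta\in(0,\pi)$. Let $S_\beta$ be the canonical selfadjoint extension of the operator of multiplication by the independent variable in $\mathcal B$ given by $$\operatorname{dom}(S_\beta)=\left\{g(z)=\frac{s_\beta(w)f(z)-s_\beta(z)f(w)}{\sin\beta\,(z-w)}: f\in\mathcal B,\ w\in\mathbb C\right\},\qquad (S_\beta g)(z)=z\,g(z)+\frac1{\sin\beta}f(w)s_\beta(z),$$ and let $(x_k)_k$ be an enumeration without repetition of $\operatorname{spec}(S_\beta)$ (finite or infinite).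 Let $j_\beta$ be a real entire function (i.e. $j_\beta^\#=j_\beta$) whose zeros are all simple and are exactly the points of $\operatorname{spec}(S_\beta)$. Then $s_\beta/j_\beta$ extends to a zero-free entire function, and this function belongs to $\mathcal B$ if and only if there are complex numbers $c_k$ such that $$\frac1{j_\beta(z)}=\sum_k\frac{c_k}{z-x_k}\qquad\text{and}\qquad \sum_k|c_k|^2\left|\frac{s_\beta'(x_k)}{s_0(x_k)}\right|<\infty,$$ where the first series converges uniformly on compact subsets of $\mathbb C\setminus\operatorname{spec}(S_\beta)$. -/

import Mathlib

open scoped ENNReal NNReal ComplexConjugate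

noncomputable section

/-- A Hermite-Biehler function: an entire function `e` with `|e(z)| > |e(conj z)|` for `z` in the
open upper half-plane. -/
def IsHermiteBiehler (e : ℂ → ℂ) : Prop :=
  Differentiable ℂ e ∧ ∀ z : ℂ, 0 < z.im → ‖e (conj z)‖ < ‖e z‖

/-- The reflection `f^#(z) = conj (f (conj z))`. -/
def sharp (f : ℂ → ℂ) : ℂ → ℂ := fun z => conj (f (conj z))

/-- Membership in the Hardy space `H_2` of the upper half-plane: `f` is holomorphic there and the
`L_2`-norms of `f` along horizontal lines are bounded. -/
def MemHardyTwo (f : ℂ → ℂ) : Prop :=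
  DifferentiableOn ℂ f {z : ℂ | 0 < z.im} ∧
    ∃ C : ℝ≥0, ∀ y : ℝ, 0 < y →
      ∫⁻ x : ℝ, ‖f ((x : ℂ) + (y : ℂ) * Complex.I)‖ₑ ^ 2 ≤ C

theorem MemHardyTwo.zero : MemHardyTwo (fun _ => 0) :=
  ⟨differentiableOn_const _, 0, fun y _ => by simp⟩

theorem MemHardyTwo.add {f g : ℂ → ℂ} (hf : MemHardyTwo f) (hg : MemHardyTwo g) :
    MemHardyTwo (fun z => f z + g z) := by
  obtain ⟨hf, C, hC⟩ := hf
  obtain ⟨hg, D, hD⟩ := hg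
  refine ⟨hf.add hg, 2 * C + 2 * D, fun y hy => ?_⟩
  have hm : Measurable fun x : ℝ => 2 * ‖f ((x : ℂ) + (y : ℂ) * Complex.I)‖ₑ ^ 2 := by
    have hc : Continuous fun x : ℝ => f ((x : ℂ) + (y : ℂ) * Complex.I) :=
      hf.continuousOn.comp_continuous (by fun_prop) (fun x => by simpa using hy)
    exact (hc.measurable.enorm.pow_const 2).const_mul 2
  calc ∫⁻ x : ℝ, ‖f ((x : ℂ) + (y : ℂ) * Complex.I) + g ((x : ℂ) + (y : ℂ) * Complex.I)‖ₑ ^ 2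
      ≤ ∫⁻ x : ℝ, (2 * ‖f ((x : ℂ) + (y : ℂ) * Complex.I)‖ₑ ^ 2
          + 2 * ‖g ((x : ℂ) + (y : ℂ) * Complex.I)‖ₑ ^ 2) := by
        refine MeasureTheory.lintegral_mono fun x => ?_
        generalize f ((x : ℂ) + (y : ℂ) * Complex.I) = a
        generalize g ((x : ℂ) + (y : ℂ) * Complex.I) = b
        have key : ‖a + b‖₊ ^ 2 ≤ 2 * ‖a‖₊ ^ 2 + 2 * ‖b‖₊ ^ 2 := by
          rw [← NNReal.coe_le_coe]
          push_cast
          have h1 := norm_add_le a b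
          have h2 := norm_nonneg (a + b)
          nlinarith [sq_nonneg (‖a‖ - ‖b‖)]
        simp only [enorm_eq_nnnorm]
        exact_mod_cast key
    _ = 2 * (∫⁻ x : ℝ, ‖f ((x : ℂ) + (y : ℂ) * Complex.I)‖ₑ ^ 2)
          + 2 * ∫⁻ x : ℝ, ‖g ((x : ℂ) + (y : ℂ) * Complex.I)‖ₑ ^ 2 := by
        rw [MeasureTheory.lintegral_add_left hm,
          MeasureTheory.lintegral_const_mul' _ _ (by norm_num),
          MeasureTheory.lintegral_const_mul' _ _ (by norm_num)]
    _ ≤ 2 * (C : ℝ≥0∞) + 2 * (D : ℝ≥0∞) := by gcongr <;> [exact hC y hy; exact hD y hy]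
    _ = ((2 * C + 2 * D : ℝ≥0) : ℝ≥0∞) := by push_cast; rfl

theorem MemHardyTwo.const_mul {f : ℂ → ℂ} (hf : MemHardyTwo f) (a : ℂ) :
    MemHardyTwo (fun z => a * f z) := by
  obtain ⟨hf, C, hC⟩ := hf
  refine ⟨hf.const_mul a, ‖a‖₊ ^ 2 * C, fun y hy => ?_⟩
  calc ∫⁻ x : ℝ, ‖a * f ((x : ℂ) + (y : ℂ) * Complex.I)‖ₑ ^ 2
      = ‖a‖ₑ ^ 2 * ∫⁻ x : ℝ, ‖f ((x : ℂ) + (y : ℂ) * Complex.I)‖ₑ ^ 2 := by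
        rw [← MeasureTheory.lintegral_const_mul' _ _ (by simp [enorm_eq_nnnorm])]
        simp only [enorm_mul, mul_pow]
    _ ≤ ‖a‖ₑ ^ 2 * (C : ℝ≥0∞) := by gcongr; exact hC y hy
    _ = ((‖a‖₊ ^ 2 * C : ℝ≥0) : ℝ≥0∞) := by push_cast; rfl

/-- The de Branges space `B(e)`: the entire functions `f` for which `f / e` and `f^# / e` belong to
the Hardy space `H_2` of the upper half-plane. -/
def deBrangesSpace (e : ℂ → ℂ) : Submodule ℂ (ℂ → ℂ) where
  carrier := {f | Differentiable ℂ f ∧ MemHardyTwo (fun z => f z / e z) ∧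
    MemHardyTwo (fun z => sharp f z / e z)}
  zero_mem' := by
    refine ⟨differentiable_const _, ?_, ?_⟩
    · simpa using MemHardyTwo.zero
    · simpa [sharp] using MemHardyTwo.zero
  add_mem' := by
    rintro f g ⟨hf, hf1, hf2⟩ ⟨hg, hg1, hg2⟩
    refine ⟨hf.add hg, ?_, ?_⟩
    · convert hf1.add hg1 using 2
      simp [add_div]
    · convert hf2.add hg2 using 2
      simp [sharp, add_div]
  smul_mem' := by
    rintro a f ⟨hf, hf1, hf2⟩
    refine ⟨hf.const_smul a, ?_, ?_⟩
    · convert hf1.const_mul a using 2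
      simp [mul_div_assoc]
    · convert hf2.const_mul (conj a) using 2
      simp [sharp, mul_div_assoc]

/-- The norm of `B(e)`, that is, the `L_2(ℝ)`-norm of `f / e`. It is the norm of the inner product
`∫ conj (g x) * f x / |e x| ^ 2 dx`. -/
def deBrangesNorm (e : ℂ → ℂ) (f : deBrangesSpace e) : ℝ≥0∞ :=
  MeasureTheory.eLpNorm (fun x : ℝ => (f : ℂ → ℂ) x / e x) 2 MeasureTheory.volume

/-- The functions `s_β(z) = (i/2) (exp(iβ) e(z) - exp(-iβ) e^#(z))`. -/
def sFun (e : ℂ → ℂ) (β : ℝ) (z : ℂ) : ℂ :=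
  Complex.I / 2 *
    (Complex.exp (Complex.I * β) * e z - Complex.exp (-(Complex.I * β)) * sharp e z)

/-- The graph of the canonical selfadjoint extension `S_β`, `0 < β < π`, of the operator of
multiplication by the independent variable in `B(e)`. A pair `(g, h)` belongs to it if, for some
`f` in `B(e)` and some `w`, the entire function `g` is
`(s_β(w) f(z) - s_β(z) f(w)) / (sin β (z - w))` and `h(z) = z g(z) + f(w) s_β(z) / sin β`. -/
def canonicalExtension (e : ℂ → ℂ) (β : ℝ) : Set (deBrangesSpace e × deBrangesSpace e) :=
  {p | ∃ (f : deBrangesSpace e) (w : ℂ),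
    (∀ z : ℂ, z ≠ w → (p.1 : ℂ → ℂ) z =
      (sFun e β w * (f : ℂ → ℂ) z - sFun e β z * (f : ℂ → ℂ) w) / (Real.sin β * (z - w))) ∧
    ∀ z : ℂ, (p.2 : ℂ → ℂ) z =
      z * (p.1 : ℂ → ℂ) z + 1 / Real.sin β * (f : ℂ → ℂ) w * sFun e β z}

/-- The resolvent set of an operator in `B(e)` given by its graph `T`: the points `w` for which
`T - w` maps the domain bijectively onto `B(e)` with a bounded inverse. -/
def resolventSetOfGraph (e : ℂ → ℂ) (T : Set (deBrangesSpace e × deBrangesSpace e)) : Set ℂ :=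
  {w | (∀ h : deBrangesSpace e, ∃! g : deBrangesSpace e, (g, h + w • g) ∈ T) ∧
    ∃ C : ℝ≥0, ∀ p ∈ T, deBrangesNorm e p.1 ≤ C * deBrangesNorm e (p.2 - w • p.1)}

/-- The spectrum of `S_β`. -/
def specExtension (e : ℂ → ℂ) (β : ℝ) : Set ℂ :=
  (resolventSetOfGraph e (canonicalExtension e β))ᶜ

end

/-! The spectrum of `S_β` is the zero set of `s_β` (`mem_specExtension_iff`): if `s_β(w) ≠ 0`, the
resolvent is `h ↦ (h - (h(w)/s_β(w)) s_β)/(z - w)`, while at a zero `w` the function `k_w = s_β/(z -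
w)` is an eigenvector.

The zeros are real, and the `k_w` form an orthogonal system. If `m` and `(z - u)m` lie in `B(e)` for
a real `u`, Cauchy's theorem makes `m/e` and `m^#/e` integrate to zero over the line, hence `∫ m
s_γ/|e|² = 0`. This yields `s_β'(w) ⟨k_w, f⟩ = f(w) ‖k_w‖²` (`mul_inner_sKernel`). Taking `f = s_0`
shows that the zeros of `s_β` are simple, so `g = s_β/j` is entire and zero-free. Moreover `⟨k_w,
s_0⟩` does not depend on `w`, so `‖k_w‖²` is a constant times `|s_β'(w)/s_0(w)|`, which is the
weight of the theorem.

The system is complete (`eq_zero_of_vanishing_on_zeros`): a function with the pointwise bounds of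
`B(e)` that vanishes at all zeros is a multiple of `s_β`. A nonzero multiple is impossible, because
together with `s_0 ∈ B(e)` it would impose those bounds on `e` itself.

If `g ∈ B(e)`, then `g = ∑ c_k k_{x_k}` locally uniformly with `c_k = g(x_k)/s_β'(x_k) = 1/j'(x_k)`.
Division by `s_β` gives the expansion of `1/j`, and Bessel's inequality gives the weighted sum.
Conversely, the weighted sum bounds the norms of the partial sums of `∑ c_k k_{x_k}`, which converge
pointwise to `s_β/j = g` off the real axis; Fatou's lemma then puts `g` in `B(e)`. -/

open MeasureTheory Filter Topology

/-! ### Hardy functions on horizontal lines -/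

/-- The squared `L_2`-norm of `F` along the horizontal line at height `y`. -/
noncomputable def lineSq (F : ℂ → ℂ) (y : ℝ) : ℝ≥0∞ :=
  ∫⁻ x : ℝ, ‖F ((x : ℂ) + (y : ℂ) * Complex.I)‖ₑ ^ 2

theorem im_line (x y : ℝ) : ((x : ℂ) + (y : ℂ) * Complex.I).im = y := by simp

theorem norm_setIntegral_mul_le {f g : ℝ → ℂ} {s : Set ℝ} {A B : ℝ} (hA : 0 ≤ A) (hB : 0 ≤ B)
    (hf : AEStronglyMeasurable f (volume.restrict s))
    (hg : AEStronglyMeasurable g (volume.restrict s))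
    (hfA : ∫⁻ t, ‖f t‖ₑ ^ 2 ≤ ENNReal.ofReal (A ^ 2))
    (hgB : ∫⁻ t in s, ‖g t‖ₑ ^ 2 ≤ ENNReal.ofReal (B ^ 2)) :
    ‖∫ t in s, f t * g t‖ ≤ A * B := by
  have h1 : ‖∫ t in s, f t * g t‖ₑ ≤ ENNReal.ofReal A * ENNReal.ofReal B := by
    calc ‖∫ t in s, f t * g t‖ₑ ≤ ∫⁻ t in s, ‖f t * g t‖ₑ := enorm_integral_le_lintegral_enorm _
      _ = ∫⁻ t in s, ((fun t => ‖f t‖ₑ) * fun t => ‖g t‖ₑ) t := by simp [enorm_mul]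
      _ ≤ (∫⁻ t in s, ‖f t‖ₑ ^ (2 : ℝ)) ^ (1 / (2 : ℝ)) *
          (∫⁻ t in s, ‖g t‖ₑ ^ (2 : ℝ)) ^ (1 / (2 : ℝ)) :=
        ENNReal.lintegral_mul_le_Lp_mul_Lq _ Real.HolderConjugate.two_two hf.enorm hg.enorm
      _ ≤ (ENNReal.ofReal (A ^ 2)) ^ (1 / (2 : ℝ)) * (ENNReal.ofReal (B ^ 2)) ^ (1 / (2 : ℝ)) := by
        have e1 : ∫⁻ t in s, ‖f t‖ₑ ^ (2 : ℝ) ≤ ENNReal.ofReal (A ^ 2) := by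
          refine le_trans (lintegral_mono' Measure.restrict_le_self le_rfl) ?_
          simpa [ENNReal.rpow_two] using hfA
        have e2 : ∫⁻ t in s, ‖g t‖ₑ ^ (2 : ℝ) ≤ ENNReal.ofReal (B ^ 2) := by
          simpa [ENNReal.rpow_two] using hgB
        gcongr
      _ = ENNReal.ofReal A * ENNReal.ofReal B := by
        rw [ENNReal.ofReal_rpow_of_nonneg (by positivity) (by norm_num),
          ENNReal.ofReal_rpow_of_nonneg (by positivity) (by norm_num), ← Real.sqrt_eq_rpow,
          ← Real.sqrt_eq_rpow, Real.sqrt_sq hA, Real.sqrt_sq hB]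
  rw [← ENNReal.ofReal_mul hA, ← ofReal_norm] at h1
  exact (ENNReal.ofReal_le_ofReal_iff (by positivity)).1 h1

/-- The restriction of `F` to the closed upper half-plane, extended by projecting. -/
noncomputable def clampIm (F : ℂ → ℂ) (z : ℂ) : ℂ :=
  F ((z.re : ℂ) + ((max z.im 0 : ℝ) : ℂ) * Complex.I)

theorem clampIm_of_nonneg (F : ℂ → ℂ) {z : ℂ} (hz : 0 ≤ z.im) : clampIm F z = F z := by
  rw [clampIm, max_eq_left hz, Complex.re_add_im]

theorem continuous_clampIm {F : ℂ → ℂ} (hF : ContinuousOn F {z | 0 ≤ z.im}) :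
    Continuous (clampIm F) :=
  hF.comp_continuous (by fun_prop) (fun z => by simp)

theorem continuous_line {F : ℂ → ℂ} (hF : ContinuousOn F {z | 0 ≤ z.im}) {y : ℝ} (hy : 0 ≤ y) :
    Continuous fun x : ℝ => F ((x : ℂ) + (y : ℂ) * Complex.I) :=
  hF.comp_continuous (by fun_prop) (fun x => by simpa using hy)

/-- Fatou's lemma along the heights `1 / (n + 1)`. -/
theorem lineSq_zero_le {F : ℂ → ℂ} (hF : ContinuousOn F {z | 0 ≤ z.im}) {C : ℝ≥0∞}
    (hC : ∀ y : ℝ, 0 < y → lineSq F y ≤ C) : lineSq F 0 ≤ C := by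
  have hlim : ∀ x : ℝ, Tendsto (fun n : ℕ => ‖F ((x : ℂ) + ((1 / ((n : ℝ) + 1) : ℝ) : ℂ) *
      Complex.I)‖ₑ ^ 2) atTop (𝓝 (‖F ((x : ℂ) + ((0 : ℝ) : ℂ) * Complex.I)‖ₑ ^ 2)) := by
    intro x
    have hc : Continuous fun y : ℝ => ‖clampIm F ((x : ℂ) + (y : ℂ) * Complex.I)‖ₑ ^ 2 := by
      have := continuous_clampIm hF
      exact (ENNReal.continuous_pow 2).comp (by fun_prop)
    have := (hc.tendsto 0).comp tendsto_one_div_add_atTop_nhds_zero_nat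
    rw [clampIm_of_nonneg F (by simp)] at this
    refine this.congr fun n => ?_
    have : 0 ≤ 1 / ((n : ℝ) + 1) := by positivity
    simp only [Function.comp]
    rw [clampIm_of_nonneg F (by rw [im_line]; exact this)]
  calc lineSq F 0 = ∫⁻ x : ℝ, liminf (fun n : ℕ => ‖F ((x : ℂ) + ((1 / ((n : ℝ) + 1) : ℝ) : ℂ) *
      Complex.I)‖ₑ ^ 2) atTop := lintegral_congr fun x => (hlim x).liminf_eq.symm
    _ ≤ liminf (fun n : ℕ => lineSq F (1 / ((n : ℝ) + 1))) atTop := by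
      refine lintegral_liminf_le fun n => ?_
      exact (continuous_line hF (by positivity)).measurable.enorm.pow_const 2
    _ ≤ C := by
      refine liminf_le_of_le (by isBoundedDefault) fun b hb => ?_
      obtain ⟨n, hn⟩ := hb.exists
      exact hn.trans (hC _ (by positivity))

/-- A bounded holomorphic function on the upper half-plane is bounded by its boundary values. -/
theorem norm_le_of_bounded_upperHalfPlane {h : ℂ → ℂ} {M C : ℝ}
    (hc : ContinuousOn h {z | 0 ≤ z.im}) (hd : DifferentiableOn ℂ h {z | 0 < z.im})
    (hM : ∀ z : ℂ, 0 ≤ z.im → ‖h z‖ ≤ M) (hC : ∀ x : ℝ, ‖h x‖ ≤ C) {z : ℂ} (hz : 0 ≤ z.im) :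
    ‖h z‖ ≤ C := by
  have key := PhragmenLindelof.right_half_plane_of_bounded_on_real (f := fun ζ => h (Complex.I * ζ))
    (C := C) (z := -Complex.I * z) ?_ ?_ ?_ ?_ (by simpa using hz)
  · simpa [← mul_assoc] using key
  · refine ⟨hd.comp (by fun_prop) fun ζ hζ => by simpa using hζ, ?_⟩
    refine hc.comp (by fun_prop) fun ζ hζ => ?_
    have : ζ ∈ {z : ℂ | 0 ≤ z.re} :=
      closure_minimal (fun w hw => le_of_lt (by simpa using hw))
        (isClosed_le continuous_const Complex.continuous_re) hζ
    simpa using this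
  · refine ⟨1, by norm_num, 0, Asymptotics.IsBigO.of_bound M ?_⟩
    refine eventually_inf_principal.2 (Eventually.of_forall fun ζ hζ => ?_)
    simpa using hM (Complex.I * ζ) (by simpa using le_of_lt hζ)
  · refine isBoundedUnder_of_eventually_le (a := M) ?_
    filter_upwards [eventually_ge_atTop 0] with x hx
    exact hM _ (by simpa using hx)
  · intro x
    have : Complex.I * (x * Complex.I) = ((-x : ℝ) : ℂ) := by
      push_cast; linear_combination x * Complex.I_mul_I
    rw [this]; exact hC _

/-- Pairing of a horizontal translate of `F` with `φ` on `[a, b]`. -/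
noncomputable def windowIntegral (F : ℂ → ℂ) (φ : ℝ → ℂ) (a b : ℝ) (z : ℂ) : ℂ :=
  ∫ t in a..b, F (z + t) * φ t

theorem continuousOn_windowIntegral {F : ℂ → ℂ} {φ : ℝ → ℂ} (hF : ContinuousOn F {z | 0 ≤ z.im})
    (hφ : Continuous φ) (a b : ℝ) : ContinuousOn (windowIntegral F φ a b) {z | 0 ≤ z.im} := by
  have hc := continuous_clampIm hF
  have h : Continuous fun z : ℂ => ∫ t in a..b, clampIm F (z + t) * φ t :=
    intervalIntegral.continuous_parametric_intervalIntegral_of_continuous' (by fun_prop) a b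
  refine h.continuousOn.congr fun z hz => ?_
  refine intervalIntegral.integral_congr fun t _ => ?_
  rw [clampIm_of_nonneg F (by simpa using hz)]

theorem hasDerivAt_windowIntegral {F : ℂ → ℂ} {φ : ℝ → ℂ}
    (hF : DifferentiableOn ℂ F {z | 0 < z.im}) (hφ : Continuous φ) (a b : ℝ) {z : ℂ}
    (hz : 0 < z.im) :
    HasDerivAt (windowIntegral F φ a b) (∫ t in a..b, deriv F (z + t) * φ t) z := by
  have hopen : IsOpen {z : ℂ | 0 < z.im} := isOpen_lt continuous_const Complex.continuous_im
  have hd' : ContinuousOn (deriv F) {z | 0 < z.im} := (hF.deriv hopen).continuousOn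
  have hball : ∀ w ∈ Metric.closedBall z (z.im / 2), 0 < w.im := by
    intro w hw
    have h1 := Complex.abs_im_le_norm (w - z)
    have h2 : ‖w - z‖ ≤ z.im / 2 := by simpa [dist_eq_norm] using hw
    have h3 := neg_abs_le (w - z).im
    simp only [Complex.sub_im] at h1 h3
    linarith
  set K : Set (ℂ × ℝ) := Metric.closedBall z (z.im / 2) ×ˢ Set.uIcc a b
  have hK : IsCompact K := (isCompact_closedBall _ _).prod isCompact_uIcc
  have hcont : ContinuousOn (fun p : ℂ × ℝ => deriv F (p.1 + p.2) * φ p.2) K := by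
    refine ContinuousOn.mul (hd'.comp (by fun_prop) fun p hp => ?_) (by fun_prop)
    simpa using hball _ hp.1
  obtain ⟨B, hB⟩ := hK.exists_bound_of_continuousOn hcont
  have hline : ∀ G : ℂ → ℂ, ContinuousOn G {z | 0 < z.im} → ∀ w : ℂ, 0 < w.im →
      Continuous fun t : ℝ => G (w + t) * φ t := fun G hG w hw =>
    (hG.comp_continuous (by fun_prop) (fun t => by simpa using hw)).mul hφ
  have hs : Metric.ball z (z.im / 2) ∈ 𝓝 z := Metric.ball_mem_nhds _ (by linarith)
  refine (intervalIntegral.hasDerivAt_integral_of_dominated_loc_of_deriv_le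
    (F := fun w (t : ℝ) => F (w + t) * φ t) (F' := fun w (t : ℝ) => deriv F (w + t) * φ t)
    (bound := fun _ => B) hs ?_ ?_ ?_ ?_ intervalIntegrable_const ?_).2
  · filter_upwards [hs] with w hw
    exact (hline F hF.continuousOn w
      (hball w (Metric.ball_subset_closedBall hw))).aestronglyMeasurable
  · exact (hline F hF.continuousOn z hz).intervalIntegrable _ _
  · exact (hline _ hd' z hz).aestronglyMeasurable
  · refine Eventually.of_forall fun t ht w hw => ?_
    exact hB (w, t) ⟨Metric.ball_subset_closedBall hw, Set.uIoc_subset_uIcc ht⟩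
  · refine Eventually.of_forall fun t ht w hw => ?_
    have hw' := hball w (Metric.ball_subset_closedBall hw)
    have : HasDerivAt F (deriv F (w + t)) (w + t) :=
      (hF.differentiableAt (hopen.mem_nhds (by simpa using hw'))).hasDerivAt
    exact (HasDerivAt.comp_add_const w (t : ℂ) this).mul_const _

theorem norm_windowIntegral_le {F : ℂ → ℂ} {φ : ℝ → ℂ} (hF : ContinuousOn F {z | 0 ≤ z.im})
    (hφ : Continuous φ) {a b : ℝ} (hab : a ≤ b) {A B : ℝ} (hA : 0 ≤ A) (hB : 0 ≤ B) {z : ℂ}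
    (hz : 0 ≤ z.im) (hFA : lineSq F z.im ≤ ENNReal.ofReal (A ^ 2))
    (hφB : ∫⁻ t in Set.Ioc a b, ‖φ t‖ₑ ^ 2 ≤ ENNReal.ofReal (B ^ 2)) :
    ‖windowIntegral F φ a b z‖ ≤ A * B := by
  rw [windowIntegral, intervalIntegral.integral_of_le hab]
  refine norm_setIntegral_mul_le hA hB ?_ hφ.aestronglyMeasurable ?_ hφB
  · exact (hF.comp_continuous (f := fun t : ℝ => z + t) (by fun_prop)
      (fun t => by simpa using hz)).aestronglyMeasurable
  · refine le_trans (le_of_eq ?_) hFA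
    rw [lineSq, ← lintegral_add_right_eq_self (fun x : ℝ => ‖F (x + z.im * Complex.I)‖ₑ ^ 2) z.re]
    refine lintegral_congr fun t => ?_
    congr 3
    conv_lhs => rw [← Complex.re_add_im z]
    push_cast
    ring

/-- The `L_2`-norms of a Hardy function along horizontal lines are at most the boundary norm. -/
theorem lineSq_le_lineSq_zero {F : ℂ → ℂ} (hc : ContinuousOn F {z | 0 ≤ z.im})
    (hF : MemHardyTwo F) {y : ℝ} (hy : 0 ≤ y) : lineSq F y ≤ lineSq F 0 := by
  obtain ⟨hd, C, hC⟩ := hF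
  have h0 : lineSq F 0 ≤ C := lineSq_zero_le hc hC
  have hCy : ∀ y, 0 ≤ y → lineSq F y ≤ ENNReal.ofReal (Real.sqrt C ^ 2) := by
    intro y hy
    rw [Real.sq_sqrt C.coe_nonneg, ENNReal.ofReal_coe_nnreal]
    rcases hy.eq_or_lt with rfl | hy
    · exact h0
    · exact hC y hy
  set N : ℝ := Real.sqrt (lineSq F 0).toReal
  have hN : ENNReal.ofReal (N ^ 2) = lineSq F 0 := by
    rw [Real.sq_sqrt ENNReal.toReal_nonneg, ENNReal.ofReal_toReal]
    exact ne_top_of_le_ne_top ENNReal.coe_ne_top h0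
  -- Duality: the norm at height `y` is recovered by pairing with the conjugate of `F` on that line.
  -- Restricting to a bounded window keeps the pairing holomorphic in the translation parameter.
  set φ : ℝ → ℂ := fun t => conj (F ((t : ℂ) + (y : ℂ) * Complex.I))
  have hφ : Continuous φ := Complex.continuous_conj.comp (continuous_line hc hy)
  have key : ∀ n : ℕ, ∫⁻ t in Set.Ioc (-(n : ℝ)) n, ‖φ t‖ₑ ^ 2 ≤ lineSq F 0 := by
    intro n
    have hn : -(n : ℝ) ≤ n := by linarith [Nat.cast_nonneg (α := ℝ) n]
    set J : ℝ := ∫ t in Set.Ioc (-(n : ℝ)) n, ‖φ t‖ ^ 2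
    have hJ0 : 0 ≤ J := integral_nonneg fun t => by positivity
    have hJ : ∫⁻ t in Set.Ioc (-(n : ℝ)) n, ‖φ t‖ₑ ^ 2 = ENNReal.ofReal J := by
      rw [ofReal_integral_eq_lintegral_ofReal]
      · refine lintegral_congr fun t => ?_
        rw [ENNReal.ofReal_pow (norm_nonneg _), ofReal_norm]
      · exact (hφ.norm.pow 2).integrableOn_Ioc
      · exact Eventually.of_forall fun t => by positivity
    have hB : ∫⁻ t in Set.Ioc (-(n : ℝ)) n, ‖φ t‖ₑ ^ 2 ≤ ENNReal.ofReal (Real.sqrt J ^ 2) := by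
      rw [hJ, Real.sq_sqrt hJ0]
    -- Cauchy–Schwarz bounds the pairing by `N √J` on the real axis, and Phragmén–Lindelöf carries
    -- the bound to `iy`, where the pairing equals `J`. Hence `J ≤ N √J`, that is `J ≤ N²`.
    have hPL : ‖windowIntegral F φ (-n) n (y * Complex.I)‖ ≤ N * Real.sqrt J := by
      refine norm_le_of_bounded_upperHalfPlane (M := Real.sqrt C * Real.sqrt J)
        (continuousOn_windowIntegral hc hφ _ _)
        (fun z hz =>
          (hasDerivAt_windowIntegral hd hφ _ _ hz).differentiableAt.differentiableWithinAt)
        (fun z hz => norm_windowIntegral_le hc hφ hn (by positivity) (by positivity) hz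
          (hCy _ hz) hB)
        (fun x => norm_windowIntegral_le hc hφ hn (by positivity) (by positivity) (by simp)
          (by simp [hN]) hB) (by simpa using hy)
    have hval : windowIntegral F φ (-n) n (y * Complex.I) = J := by
      rw [windowIntegral, intervalIntegral.integral_of_le hn, ← integral_complex_ofReal]
      refine integral_congr_ae (Eventually.of_forall fun t => ?_)
      simp only [φ]
      rw [add_comm, Complex.mul_conj, Complex.normSq_eq_norm_sq]
      simp
    rw [hval, Complex.norm_real, Real.norm_of_nonneg hJ0] at hPL
    rw [hJ, ← hN]
    refine ENNReal.ofReal_le_ofReal ?_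
    have h1 := Real.sq_sqrt hJ0
    have h2 : 0 ≤ N := Real.sqrt_nonneg _
    have h3 := Real.sqrt_nonneg J
    nlinarith [sq_nonneg (N - Real.sqrt J)]
  have hmono : ∫⁻ t, ‖φ t‖ₑ ^ 2 ≤ lineSq F 0 := by
    have hU : (⋃ n : ℕ, Set.Ioc (-(n : ℝ)) n) = Set.univ := by
      refine Set.eq_univ_of_forall fun t => ?_
      obtain ⟨n, hn⟩ := exists_nat_gt |t|
      exact Set.mem_iUnion.2 ⟨n, (abs_lt.1 hn).1, (abs_lt.1 hn).2.le⟩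
    rw [← setLIntegral_univ, ← hU, setLIntegral_iUnion_of_directed]
    · exact iSup_le key
    · refine (directed_of_isDirected_le fun m n hmn => ?_)
      have : (m : ℝ) ≤ n := by exact_mod_cast hmn
      exact Set.Ioc_subset_Ioc (by linarith) this
  refine le_trans (le_of_eq ?_) hmono
  exact lintegral_congr fun t => by simp [φ]

/-- Pointwise bound for Hardy functions in terms of the boundary norm. -/
theorem norm_mul_sqrt_im_le {F : ℂ → ℂ} (hc : ContinuousOn F {z | 0 ≤ z.im}) (hF : MemHardyTwo F)
    {N : ℝ} (hN : 0 ≤ N) (h0 : lineSq F 0 ≤ ENNReal.ofReal (N ^ 2)) {z : ℂ} (hz : 0 < z.im) :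
    ‖F z‖ * Real.sqrt z.im ≤ 3 * N := by
  have hopen : IsOpen {z : ℂ | 0 < z.im} := isOpen_lt continuous_const Complex.continuous_im
  have hline : ∀ y, 0 ≤ y → lineSq F y ≤ ENNReal.ofReal (N ^ 2) := fun y hy =>
    (lineSq_le_lineSq_zero hc hF hy).trans h0
  have hone : Continuous fun _ : ℝ => (1 : ℂ) := continuous_const
  have hW : ∀ δ : ℝ, 0 ≤ δ → ∀ w : ℂ, 0 ≤ w.im →
      ‖windowIntegral F (fun _ => 1) 0 δ w‖ ≤ N * Real.sqrt δ := by
    intro δ hδ w hw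
    refine norm_windowIntegral_le hc hone hδ hN (Real.sqrt_nonneg _) hw (hline _ hw) ?_
    simp [Real.sq_sqrt hδ]
  have hd := hF.1
  have hcd : ContinuousOn (deriv F) {z | 0 < z.im} := (hd.deriv hopen).continuousOn
  have hmem : ∀ t : ℝ, z + t ∈ {z : ℂ | 0 < z.im} := fun t => by simpa using hz
  -- `F(z + t) - F(z)` is the derivative at `z` of `∫_0^t F(· + s) ds`, which is at most `N √t` on
  -- the half-plane; this is Cauchy's estimate on the disc of radius `Im z / 2`.
  have hdiff : ∀ t : ℝ, 0 ≤ t → ‖F (z + t) - F z‖ ≤ N * Real.sqrt t / (z.im / 2) := by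
    intro t ht
    have h1 : deriv (windowIntegral F (fun _ => 1) 0 t) z = F (z + t) - F z := by
      rw [(hasDerivAt_windowIntegral hd hone 0 t hz).deriv]
      have := intervalIntegral.integral_eq_sub_of_hasDerivAt (a := 0) (b := t)
        (f := fun s : ℝ => F (z + s)) (f' := fun s : ℝ => deriv F (z + s)) (fun s _ => ?_) ?_
      · simpa using this
      · have h2 : HasDerivAt F (deriv F (z + s)) (z + s) :=
          (hd.differentiableAt (hopen.mem_nhds (hmem s))).hasDerivAt
        exact (HasDerivAt.comp_const_add z (s : ℂ) h2).comp_ofReal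
      · exact (hcd.comp_continuous (by fun_prop) hmem).intervalIntegrable _ _
    rw [← h1]
    refine Complex.norm_deriv_le_of_forall_mem_sphere_norm_le (by linarith) ?_ fun w hw => ?_
    · refine DifferentiableOn.diffContOnCl (s := Metric.ball z (z.im / 2)) fun w hw => ?_
      refine (hasDerivAt_windowIntegral hd hone 0 t ?_).differentiableAt.differentiableWithinAt
      have hw' := Metric.closure_ball_subset_closedBall hw
      have h1 := Complex.abs_im_le_norm (w - z)
      have h2 : ‖w - z‖ ≤ z.im / 2 := by simpa [dist_eq_norm] using hw'
      have h3 := neg_abs_le (w - z).im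
      simp only [Complex.sub_im] at h1 h3
      linarith
    · refine hW t ht w ?_
      have h1 := Complex.abs_im_le_norm (w - z)
      have h2 : ‖w - z‖ = z.im / 2 := by simpa [dist_eq_norm] using hw
      have h3 := neg_abs_le (w - z).im
      simp only [Complex.sub_im] at h1 h3
      linarith
  set y := z.im
  have hs := Real.sqrt_pos.2 hz
  have hsq := Real.sq_sqrt hz.le
  have hw0 := hW y hz.le z hz.le
  -- Comparison of `y F(z)` with the integral of `F(z + ·)` over a window of length `y`: the error
  -- is at most `2N √y` and the integral at most `N √y`, whence the constant 3.
  have hint : ‖windowIntegral F (fun _ => 1) 0 y z - y * F z‖ ≤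
      N * Real.sqrt y / (y / 2) * |y - 0| := by
    have : windowIntegral F (fun _ => 1) 0 y z - y * F z
        = ∫ t in (0 : ℝ)..y, (F (z + t) - F z) := by
      rw [intervalIntegral.integral_sub]
      · simp [windowIntegral]
      · exact (hd.continuousOn.comp_continuous (by fun_prop) hmem).intervalIntegrable _ _
      · simp
    rw [this]
    refine intervalIntegral.norm_integral_le_of_norm_le_const fun t ht => ?_
    rw [Set.uIoc_of_le hz.le] at ht
    refine (hdiff t ht.1.le).trans ?_
    have := Real.sqrt_le_sqrt ht.2
    gcongr
  have hyF : ‖(y : ℂ) * F z‖ ≤ 3 * N * Real.sqrt y := by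
    have h1 : N * Real.sqrt y / (y / 2) * |y - 0| = 2 * N * Real.sqrt y := by
      rw [sub_zero, abs_of_pos hz]; field_simp
    have h2 := norm_sub_norm_le ((y : ℂ) * F z) (windowIntegral F (fun _ => 1) 0 y z)
    rw [norm_sub_rev] at h2
    linarith
  rw [norm_mul, Complex.norm_real, Real.norm_of_nonneg hz.le] at hyF
  refine le_of_mul_le_mul_right ?_ hs
  calc ‖F z‖ * Real.sqrt y * Real.sqrt y = y * ‖F z‖ := by
        rw [mul_assoc, ← sq, hsq]; ring
    _ ≤ _ := hyF

/-! ### Growth estimates for holomorphic functions -/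

/-- The hypothesis degenerates only at `±2R`. On the circle, `|z² - 4R²| = 4R |Im z|`, so `F(z)(z² -
4R²)²` is bounded by `16R²M` there and inside by the maximum principle. On the smaller disc the
added factor is at least `(3R²)²`. -/
theorem norm_le_of_norm_mul_im_sq_le {F : ℂ → ℂ} (hF : Differentiable ℂ F) {R M : ℝ} (hR : 0 < R)
    (hM : ∀ z : ℂ, ‖z‖ = 2 * R → ‖F z‖ * z.im ^ 2 ≤ M) {z : ℂ} (hz : ‖z‖ ≤ R) :
    ‖F z‖ ≤ 2 * M / R ^ 2 := by
  have hM0 : 0 ≤ M := le_trans (by positivity)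
    (hM ((2 * R : ℝ) : ℂ) (by rw [Complex.norm_real, Real.norm_of_nonneg (by positivity)]))
  set G : ℂ → ℂ := fun z => F z * (z ^ 2 - 4 * (R : ℂ) ^ 2) ^ 2
  have hb : ‖G z‖ ≤ 16 * R ^ 2 * M := by
    refine Complex.norm_le_of_forall_mem_frontier_norm_le (U := Metric.ball 0 (2 * R))
      Metric.isBounded_ball (Differentiable.diffContOnCl (by fun_prop)) (fun w hw => ?_) ?_
    · rw [frontier_ball _ (by positivity)] at hw
      have hw' : ‖w‖ = 2 * R := by simpa using hw
      have h1 : w * conj w = 4 * (R : ℂ) ^ 2 := by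
        rw [Complex.mul_conj, Complex.normSq_eq_norm_sq, hw']; push_cast; ring
      have h2 : w ^ 2 - 4 * (R : ℂ) ^ 2 = w * ((2 * w.im : ℝ) * Complex.I) := by
        rw [← h1, ← Complex.sub_conj]; ring
      have h3 : ‖w ^ 2 - 4 * (R : ℂ) ^ 2‖ ^ 2 = 16 * R ^ 2 * w.im ^ 2 := by
        rw [h2, norm_mul, norm_mul, Complex.norm_real, Complex.norm_I, mul_one, mul_pow, hw',
          Real.norm_eq_abs, sq_abs]
        ring
      simp only [G]
      rw [norm_mul, norm_pow, h3]
      nlinarith [hM w hw', sq_nonneg R]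
    · exact subset_closure (by simpa using hz.trans_lt (by linarith))
  have h1 : 3 * R ^ 2 ≤ ‖z ^ 2 - 4 * (R : ℂ) ^ 2‖ := by
    have h2 := norm_sub_norm_le (4 * (R : ℂ) ^ 2) (z ^ 2)
    rw [norm_sub_rev] at h2
    have h3 : ‖4 * (R : ℂ) ^ 2‖ = 4 * R ^ 2 := by simp
    rw [h3, norm_pow] at h2
    nlinarith [norm_nonneg z]
  simp only [G] at hb
  rw [norm_mul, norm_pow] at hb
  have h4 : (3 * R ^ 2) ^ 2 ≤ ‖z ^ 2 - 4 * (R : ℂ) ^ 2‖ ^ 2 := by gcongr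
  have h5 : ‖F z‖ * (3 * R ^ 2) ^ 2 ≤ 16 * R ^ 2 * M :=
    (mul_le_mul_of_nonneg_left h4 (norm_nonneg _)).trans hb
  rw [le_div_iff₀ (by positivity)]
  refine le_of_mul_le_mul_right ?_ (show 0 < 9 * R ^ 2 by positivity)
  nlinarith [mul_nonneg (sq_nonneg R) hM0]

theorem eq_of_norm_le_sqrt {F : ℂ → ℂ} (hF : Differentiable ℂ F) {C : ℝ}
    (hC : ∀ R : ℝ, 1 ≤ R → ∀ z : ℂ, ‖z‖ ≤ R → ‖F z‖ ≤ C * Real.sqrt R) (z w : ℂ) : F z = F w := by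
  refine is_const_of_deriv_eq_zero hF (fun z => ?_) z w
  have hlim : Tendsto (fun R : ℝ => C * Real.sqrt 2 / Real.sqrt R) atTop (𝓝 0) :=
    Tendsto.div_atTop tendsto_const_nhds Real.tendsto_sqrt_atTop
  have hle : ∀ᶠ R : ℝ in atTop, ‖deriv F z‖ ≤ C * Real.sqrt 2 / Real.sqrt R := by
    filter_upwards [eventually_ge_atTop 1, eventually_ge_atTop ‖z‖] with R hR hzR
    have hR0 : 0 < R := by linarith
    have := Complex.norm_deriv_le_of_forall_mem_sphere_norm_le (c := z) (R := R)
      (C := C * Real.sqrt (2 * R)) (f := F) hR0 hF.diffContOnCl fun w hw => by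
        refine hC _ (by linarith) w ?_
        have h1 : ‖w - z‖ = R := by simpa [dist_eq_norm] using hw
        have h2 := norm_add_le (w - z) z
        rw [sub_add_cancel] at h2
        linarith
    refine this.trans (le_of_eq ?_)
    rw [Real.sqrt_mul (by norm_num)]
    have h3 := Real.sq_sqrt hR0.le
    have h4 := Real.sqrt_pos.2 hR0
    field_simp
    rw [h3]
  exact norm_le_zero_iff.1 (ge_of_tendsto hlim hle)

/-- Growth bound for a holomorphic function with positive real part on the upper half-plane. -/
theorem exists_norm_le_of_re_pos {H : ℂ → ℂ} (hd : DifferentiableOn ℂ H {z | 0 < z.im})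
    (hre : ∀ z : ℂ, 0 < z.im → 0 < (H z).re) :
    ∃ C : ℝ, 0 ≤ C ∧ ∀ z : ℂ, 0 < z.im → ‖H z‖ * z.im ≤ C * (1 + ‖z‖) ^ 2 := by
  set a := H Complex.I
  have ha : 0 < a.re := hre _ (by simp)
  set c : ℂ → ℂ := fun ζ => Complex.I * (1 + ζ) / (1 - ζ)
  have hne1 : ∀ ζ : ℂ, ‖ζ‖ < 1 → 1 - ζ ≠ 0 := fun ζ hζ h => by
    rw [← sub_eq_zero.1 h] at hζ; simp at hζ
  have hcim : ∀ ζ : ℂ, ‖ζ‖ < 1 → 0 < (c ζ).im := by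
    intro ζ hζ
    have h1 : 0 < Complex.normSq (1 - ζ) := Complex.normSq_pos.2 (hne1 ζ hζ)
    have h2 : Complex.normSq ζ < 1 := by
      rw [Complex.normSq_eq_norm_sq]; nlinarith [norm_nonneg ζ]
    have h3 : (c ζ).im = (1 - Complex.normSq ζ) / Complex.normSq (1 - ζ) := by
      simp only [c, Complex.div_im]
      simp [Complex.normSq_apply]
      field_simp
      ring
    rw [h3]
    exact div_pos (by linarith) h1
  have hden : ∀ b : ℂ, 0 < b.re → b + conj a ≠ 0 := fun b hb h => by
    have := congrArg Complex.re h
    simp at this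
    linarith
  -- Cayley transforms on both sides, sending `i` and `H(i)` to the origin, turn `H` into a self-map
  -- of the disc, to which the Schwarz lemma applies.
  set ψ : ℂ → ℂ := fun ζ => (H (c ζ) - a) / (H (c ζ) + conj a)
  have hψd : DifferentiableOn ℂ ψ (Metric.ball 0 1) := by
    have hc : DifferentiableOn ℂ c (Metric.ball 0 1) :=
      DifferentiableOn.div (by fun_prop) (by fun_prop) fun ζ hζ => hne1 ζ (by simpa using hζ)
    have hH : DifferentiableOn ℂ (fun ζ => H (c ζ)) (Metric.ball 0 1) :=
      hd.comp hc fun ζ hζ => hcim ζ (by simpa using hζ)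
    exact (hH.sub_const a).div (hH.add_const _) fun ζ hζ =>
      hden _ (hre _ (hcim ζ (by simpa using hζ)))
  have hψm : Set.MapsTo ψ (Metric.ball 0 1) (Metric.closedBall 0 1) := by
    intro ζ hζ
    have hb := hre _ (hcim ζ (by simpa using hζ))
    have h1 : ‖H (c ζ) - a‖ ≤ ‖H (c ζ) + conj a‖ := by
      rw [← sq_le_sq₀ (norm_nonneg _) (norm_nonneg _), ← Complex.normSq_eq_norm_sq,
        ← Complex.normSq_eq_norm_sq, Complex.normSq_apply, Complex.normSq_apply]
      simp
      nlinarith [mul_pos hb ha]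
    simp only [ψ, mem_closedBall_zero_iff, norm_div]
    exact div_le_one_of_le₀ h1 (norm_nonneg _)
  have hψ0 : ψ 0 = 0 := by simp [ψ, c, a]
  refine ⟨‖a‖, norm_nonneg _, fun z hz => ?_⟩
  have hzi : z + Complex.I ≠ 0 := fun h => by
    have := congrArg Complex.im h
    simp at this
    linarith
  set ζ := (z - Complex.I) / (z + Complex.I)
  have hn : ‖z + Complex.I‖ ^ 2 - ‖z - Complex.I‖ ^ 2 = 4 * z.im := by
    rw [← Complex.normSq_eq_norm_sq, ← Complex.normSq_eq_norm_sq, Complex.normSq_apply,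
      Complex.normSq_apply]
    simp
    ring
  have hpos : 0 < ‖z + Complex.I‖ := norm_pos_iff.2 hzi
  have hζsq : 1 - ‖ζ‖ ^ 2 = 4 * z.im / ‖z + Complex.I‖ ^ 2 := by
    simp only [ζ, norm_div, div_pow]
    rw [← hn]; field_simp
  have hζ1 : ‖ζ‖ < 1 := by
    have : 0 < 1 - ‖ζ‖ ^ 2 := by rw [hζsq]; positivity
    nlinarith [norm_nonneg ζ]
  have hcζ : c ζ = z := by
    have h1 : 1 - ζ ≠ 0 := hne1 ζ hζ1
    have h2 : (1 - ζ) * (z + Complex.I) = 2 * Complex.I := by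
      simp only [ζ]; field_simp; ring
    have h3 : (1 + ζ) * (z + Complex.I) = 2 * z := by
      simp only [ζ]; field_simp; ring
    simp only [c]
    rw [div_eq_iff h1]
    refine mul_right_cancel₀ hzi ?_
    rw [mul_assoc, h3, mul_assoc, h2]; ring
  have hS : ‖ψ ζ‖ ≤ ‖ζ‖ := Complex.norm_le_norm_of_mapsTo_ball hψd hψm hψ0 hζ1
  -- The definition of `ψ` solved for `H`; together with `|ψ ζ| ≤ |ζ|` it bounds `‖H z‖` by `2‖a‖ /
  -- (1 - ‖ζ‖)`.
  have heq : H z - H z * ψ ζ = a + conj a * ψ ζ := by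
    simp only [ψ, hcζ]
    have := hden _ (hre z hz)
    field_simp
    ring
  have h1 : ‖H z‖ * (1 - ‖ζ‖) ≤ 2 * ‖a‖ := by
    have h2 := norm_sub_norm_le (H z) (H z * ψ ζ)
    have h3 := norm_add_le a (conj a * ψ ζ)
    rw [heq] at h2
    rw [norm_mul] at h2 h3
    rw [RCLike.norm_conj] at h3
    have h4 := mul_le_mul_of_nonneg_left hS (norm_nonneg (H z))
    have h5 : ‖a‖ * ‖ψ ζ‖ ≤ ‖a‖ * 1 :=
      mul_le_mul_of_nonneg_left (hS.trans hζ1.le) (norm_nonneg _)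
    linarith
  have h2 : 2 * z.im / ‖z + Complex.I‖ ^ 2 ≤ 1 - ‖ζ‖ := by
    have : 2 * z.im / ‖z + Complex.I‖ ^ 2 = (1 - ‖ζ‖ ^ 2) / 2 := by rw [hζsq]; ring
    rw [this]
    nlinarith [norm_nonneg ζ]
  have h3 : ‖H z‖ * (2 * z.im / ‖z + Complex.I‖ ^ 2) ≤ 2 * ‖a‖ :=
    (mul_le_mul_of_nonneg_left h2 (norm_nonneg _)).trans h1
  have h4 : ‖z + Complex.I‖ ≤ 1 + ‖z‖ := by
    have := norm_add_le z Complex.I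
    rw [Complex.norm_I] at this; linarith
  rw [mul_div_assoc', div_le_iff₀ (by positivity)] at h3
  have h5 : ‖z + Complex.I‖ ^ 2 ≤ (1 + ‖z‖) ^ 2 := by gcongr
  nlinarith [norm_nonneg a]

/-! ### Cauchy's theorem on the real line -/

theorem exists_integral_norm_sq_le {F : ℂ → ℂ} (hc : ContinuousOn F {z | 0 ≤ z.im})
    (hF : MemHardyTwo F) : ∃ K : ℝ, 0 ≤ K ∧ ∀ y : ℝ, 0 ≤ y →
      Integrable (fun x : ℝ => ‖F ((x : ℂ) + (y : ℂ) * Complex.I)‖ ^ 2) ∧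
      ∫ x : ℝ, ‖F ((x : ℂ) + (y : ℂ) * Complex.I)‖ ^ 2 ≤ K := by
  obtain ⟨C, hC⟩ := hF.2
  refine ⟨C, C.coe_nonneg, fun y hy => ?_⟩
  have h1 : lineSq F y ≤ C := (lineSq_le_lineSq_zero hc hF hy).trans (lineSq_zero_le hc hC)
  have hm : AEStronglyMeasurable (fun x : ℝ => ‖F ((x : ℂ) + (y : ℂ) * Complex.I)‖ ^ 2) :=
    ((continuous_line hc hy).norm.pow 2).aestronglyMeasurable
  have h2 : ∫⁻ x : ℝ, ENNReal.ofReal (‖F ((x : ℂ) + (y : ℂ) * Complex.I)‖ ^ 2) = lineSq F y := by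
    refine lintegral_congr fun t => ?_
    rw [ENNReal.ofReal_pow (norm_nonneg _), ofReal_norm]
  constructor
  · refine (lintegral_ofReal_ne_top_iff_integrable hm
      (Eventually.of_forall fun t => by positivity)).1 ?_
    rw [h2]
    exact ne_top_of_le_ne_top ENNReal.coe_ne_top h1
  · rw [integral_eq_lintegral_of_nonneg_ae (Eventually.of_forall fun t => by positivity) hm, h2]
    exact ENNReal.toReal_mono ENNReal.coe_ne_top h1

theorem norm_sub_ofReal_line_sq (x y u : ℝ) :
    ‖(x : ℂ) + (y : ℂ) * Complex.I - u‖ ^ 2 = (x - u) ^ 2 + y ^ 2 := by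
  rw [← Complex.normSq_eq_norm_sq, Complex.normSq_apply]
  simp
  ring

theorem integrable_inv_sq_add_sq (u : ℝ) {Y : ℝ} (hY : 0 < Y) :
    Integrable (fun x : ℝ => ((x - u) ^ 2 + Y ^ 2)⁻¹) ∧
      ∫ x : ℝ, ((x - u) ^ 2 + Y ^ 2)⁻¹ = Real.pi / Y := by
  have h1 : ∀ x : ℝ, (x ^ 2 + Y ^ 2)⁻¹ = (Y ^ 2)⁻¹ * (1 + (x / Y) ^ 2)⁻¹ := fun x => by
    field_simp
    ring
  have h2 : Integrable fun x : ℝ => (x ^ 2 + Y ^ 2)⁻¹ := by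
    simp_rw [h1]
    exact (integrable_inv_one_add_sq.comp_div hY.ne').const_mul _
  refine ⟨h2.comp_sub_right u, ?_⟩
  rw [integral_sub_right_eq_self (fun x : ℝ => (x ^ 2 + Y ^ 2)⁻¹) u]
  simp_rw [h1]
  rw [integral_const_mul, Measure.integral_comp_div (fun x : ℝ => (1 + x ^ 2)⁻¹),
    integral_univ_inv_one_add_sq, abs_of_pos hY, smul_eq_mul]
  field_simp

/-- Cauchy's theorem on the real line for a Hardy function which stays Hardy after multiplication
by `z - u`. -/
theorem integrable_and_integral_eq_zero_of_memHardyTwo {F : ℂ → ℂ} {u : ℝ}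
    (hc : ContinuousOn F {z | 0 ≤ z.im}) (hF : MemHardyTwo F)
    (hG : MemHardyTwo fun z => (z - u) * F z) :
    Integrable (fun x : ℝ => F x) ∧ ∫ x : ℝ, F x = 0 := by
  obtain ⟨K, hK0, hK⟩ := exists_integral_norm_sq_le hc hF
  obtain ⟨K', hK'0, hK'⟩ := exists_integral_norm_sq_le (F := fun z => (z - u) * F z)
    (ContinuousOn.mul (by fun_prop) hc) hG
  have hmeas : ∀ y : ℝ, 0 ≤ y →
      AEStronglyMeasurable fun x : ℝ => F ((x : ℂ) + (y : ℂ) * Complex.I) :=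
    fun y hy => (continuous_line hc hy).aestronglyMeasurable
  -- By the AM–GM inequality, `|F|` is dominated by square-integrable data of `F` and `(z - u)F`
  -- plus a Lorentzian; the integrals of these majorants are bounded uniformly in `y`.
  set b : ℝ → ℝ → ℝ := fun y x => (‖F ((x : ℂ) + (y : ℂ) * Complex.I)‖ ^ 2 +
    ‖((x : ℂ) + (y : ℂ) * Complex.I - u) * F ((x : ℂ) + (y : ℂ) * Complex.I)‖ ^ 2 +
      ((x - u) ^ 2 + 1 ^ 2)⁻¹) / 2
  have hbint : ∀ y, 0 ≤ y → Integrable (b y) := fun y hy =>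
    (((hK y hy).1.add (hK' y hy).1).add (integrable_inv_sq_add_sq u one_pos).1).div_const 2
  have hble : ∀ y, 0 ≤ y → ∫ x, b y x ≤ (K + K' + Real.pi) / 2 := by
    intro y hy
    have h1 := integral_add (hK y hy).1 (hK' y hy).1
    have h2 := integral_add ((hK y hy).1.add (hK' y hy).1) (integrable_inv_sq_add_sq u one_pos).1
    simp only [Pi.add_apply] at h2
    simp only [b]
    rw [integral_div, h2, h1, (integrable_inv_sq_add_sq u one_pos).2, div_one]
    linarith [(hK y hy).2, (hK' y hy).2]
  have hFb : ∀ y x : ℝ, ‖F ((x : ℂ) + (y : ℂ) * Complex.I)‖ ≤ b y x := by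
    intro y x
    simp only [b]
    rw [norm_mul, mul_pow, norm_sub_ofReal_line_sq]
    set n := ‖F ((x : ℂ) + (y : ℂ) * Complex.I)‖
    have hp : 0 < (x - u) ^ 2 + 1 ^ 2 := by positivity
    have h1 : n ≤ (n ^ 2 * ((x - u) ^ 2 + 1 ^ 2) + ((x - u) ^ 2 + 1 ^ 2)⁻¹) / 2 := by
      have h2 : 0 ≤ ((x - u) ^ 2 + 1 ^ 2)⁻¹ * (n * ((x - u) ^ 2 + 1 ^ 2) - 1) ^ 2 := by positivity
      have h3 : ((x - u) ^ 2 + 1 ^ 2)⁻¹ * (n * ((x - u) ^ 2 + 1 ^ 2) - 1) ^ 2 =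
          n ^ 2 * ((x - u) ^ 2 + 1 ^ 2) - 2 * n + ((x - u) ^ 2 + 1 ^ 2)⁻¹ := by
        field_simp
        ring
      linarith
    nlinarith [mul_nonneg (sq_nonneg n) (sq_nonneg y)]
  have hint : ∀ y : ℝ, 0 ≤ y → Integrable fun x : ℝ => F ((x : ℂ) + (y : ℂ) * Complex.I) :=
    fun y hy => (hbint y hy).mono' (hmeas y hy) (Eventually.of_forall (hFb y))
  -- Cauchy's theorem on the rectangles `[-R, R] × [0, Y]`.
  have hshift : ∀ Y : ℝ, 0 < Y →
      ∫ x : ℝ, F ((x : ℂ) + ((0 : ℝ) : ℂ) * Complex.I) =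
        ∫ x : ℝ, F ((x : ℂ) + (Y : ℂ) * Complex.I) := by
    intro Y hY
    have hprod : Integrable (fun p : ℝ × ℝ => clampIm F ((p.1 : ℂ) + (p.2 : ℂ) * Complex.I))
        (volume.prod (volume.restrict (Set.Ioc 0 Y))) := by
      have hcl := continuous_clampIm hc
      have hcont : Continuous fun p : ℝ × ℝ => clampIm F ((p.1 : ℂ) + (p.2 : ℂ) * Complex.I) := by
        fun_prop
      rw [integrable_prod_iff' hcont.aestronglyMeasurable]
      have hae : ∀ᵐ y ∂(volume.restrict (Set.Ioc 0 Y)), 0 ≤ y :=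
        (ae_restrict_iff' measurableSet_Ioc).2 (Eventually.of_forall fun y hy => hy.1.le)
      have hcl' : ∀ y : ℝ, 0 ≤ y → ∀ x : ℝ, clampIm F ((x : ℂ) + (y : ℂ) * Complex.I) =
          F ((x : ℂ) + (y : ℂ) * Complex.I) :=
        fun y hy x => clampIm_of_nonneg F (by rw [im_line]; exact hy)
      refine ⟨?_, ?_⟩
      · filter_upwards [hae] with y hy
        simpa only [hcl' y hy] using hint y hy
      · refine Integrable.mono' (integrable_const ((K + K' + Real.pi) / 2)) ?_ ?_
        · exact (hcont.norm.aestronglyMeasurable.prod_swap).integral_prod_right'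
        · filter_upwards [hae] with y hy
          rw [Real.norm_of_nonneg (integral_nonneg fun x => norm_nonneg _)]
          simp only [hcl' y hy]
          exact (integral_mono (hint y hy).norm (hbint y hy) (hFb y)).trans (hble y hy)
    have hV : Integrable fun R : ℝ => ∫ y in (0 : ℝ)..Y, F ((R : ℂ) + (y : ℂ) * Complex.I) := by
      refine hprod.integral_prod_left.congr (Eventually.of_forall fun R => ?_)
      simp only
      rw [intervalIntegral.integral_of_le hY.le]
      refine setIntegral_congr_fun measurableSet_Ioc fun y hy => ?_
      exact clampIm_of_nonneg F (by rw [im_line]; exact hy.1.le)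
    have hV' : Integrable fun R : ℝ => Complex.I *
        (∫ y in (0 : ℝ)..Y, F (((-R : ℝ) : ℂ) + (y : ℂ) * Complex.I)) -
        Complex.I * (∫ y in (0 : ℝ)..Y, F ((R : ℂ) + (y : ℂ) * Complex.I)) :=
      (hV.comp_neg.const_mul _).sub (hV.const_mul _)
    have hrect : ∀ R : ℝ, (∫ x in (-R)..R, F ((x : ℂ) + ((0 : ℝ) : ℂ) * Complex.I)) -
        (∫ x in (-R)..R, F ((x : ℂ) + (Y : ℂ) * Complex.I)) =
        Complex.I * (∫ y in (0 : ℝ)..Y, F (((-R : ℝ) : ℂ) + (y : ℂ) * Complex.I)) -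
        Complex.I * (∫ y in (0 : ℝ)..Y, F ((R : ℂ) + (y : ℂ) * Complex.I)) := by
      intro R
      have := Complex.integral_boundary_rect_eq_zero_of_continuousOn_of_differentiableOn F
        ⟨-R, 0⟩ ⟨R, Y⟩ (hc.mono fun w hw => ?_) (hF.1.mono fun w hw => ?_)
      · simp only [smul_eq_mul] at this
        linear_combination this
      · have h1 := hw.2
        simp only [Set.mem_preimage] at h1
        rw [Set.uIcc_of_le hY.le] at h1
        exact h1.1
      · have h1 := hw.2
        simp only [Set.mem_preimage] at h1
        rw [min_eq_left hY.le] at h1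
        exact h1.1
    have hlim := (intervalIntegral_tendsto_integral (hint 0 le_rfl) tendsto_neg_atTop_atBot
      tendsto_id).sub (intervalIntegral_tendsto_integral (hint Y hY.le) tendsto_neg_atTop_atBot
      tendsto_id)
    simp only [id] at hlim
    simp_rw [hrect] at hlim
    -- The contribution of the vertical sides is integrable in `R` and has a limit as `R → ∞`; the
    -- limit must be zero.
    refine sub_eq_zero.1 (IntegrableAtFilter.eq_zero_of_tendsto (hV'.integrableAtFilter _)
      (fun s hs => ?_) hlim)
    obtain ⟨a, ha⟩ := mem_atTop_sets.1 hs
    exact top_le_iff.1 (Real.volume_Ici (a := a) ▸ measure_mono fun x hx => ha x hx)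
  have hI : Integrable (fun x : ℝ => F x) := by simpa using hint 0 le_rfl
  refine ⟨hI, ?_⟩
  -- AM–GM with a free weight `η`: the Lorentzian of width `Y` has mass `π / Y`, so `Y → ∞` followed
  -- by `η → 0` forces the integral to vanish.
  have hbd : ∀ Y : ℝ, 0 < Y → ∀ η : ℝ, 0 < η →
      ‖∫ x : ℝ, F x‖ ≤ (η * K' + η⁻¹ * (Real.pi / Y)) / 2 := by
    intro Y hY η hη
    have h0 := hshift Y hY
    simp only [Complex.ofReal_zero, zero_mul, add_zero] at h0
    rw [h0]
    have hi := ((hK' Y hY.le).1.const_mul η).add ((integrable_inv_sq_add_sq u hY).1.const_mul η⁻¹)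
    refine (norm_integral_le_of_norm_le (hi.div_const 2)
      (Eventually.of_forall fun x => ?_)).trans ?_
    · simp only [Pi.add_apply]
      rw [norm_mul, mul_pow, norm_sub_ofReal_line_sq]
      set n := ‖F ((x : ℂ) + (Y : ℂ) * Complex.I)‖
      set s := (x - u) ^ 2 + Y ^ 2
      have hs : 0 < s := by positivity
      have h2 : 0 ≤ (η * s)⁻¹ * (η * s * n - 1) ^ 2 := by positivity
      have h3 : (η * s)⁻¹ * (η * s * n - 1) ^ 2 = η * (s * n ^ 2) - 2 * n + η⁻¹ * s⁻¹ := by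
        field_simp
        ring
      linarith
    · simp only [Pi.add_apply]
      rw [integral_div, integral_add ((hK' Y hY.le).1.const_mul η)
        ((integrable_inv_sq_add_sq u hY).1.const_mul η⁻¹), integral_const_mul, integral_const_mul,
        (integrable_inv_sq_add_sq u hY).2]
      have := (hK' Y hY.le).2
      gcongr
  have hη : ∀ η : ℝ, 0 < η → ‖∫ x : ℝ, F x‖ ≤ η * K' / 2 := by
    intro η hη
    have hlim : Tendsto (fun Y : ℝ => (η * K' + η⁻¹ * (Real.pi / Y)) / 2) atTop
        (𝓝 ((η * K' + η⁻¹ * 0) / 2)) :=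
      ((tendsto_const_nhds.div_atTop tendsto_id).const_mul _ |>.const_add _).div_const _
    rw [mul_zero, add_zero] at hlim
    refine ge_of_tendsto hlim ?_
    filter_upwards [eventually_gt_atTop 0] with Y hY using hbd Y hY η hη
  have hlim : Tendsto (fun η : ℝ => η * K' / 2) (𝓝[>] 0) (𝓝 (0 * K' / 2)) :=
    ((tendsto_nhdsWithin_of_tendsto_nhds tendsto_id).mul_const _).div_const _
  rw [zero_mul, zero_div] at hlim
  exact norm_le_zero_iff.1 (ge_of_tendsto hlim (eventually_mem_nhdsWithin.mono fun η h => hη η h))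

/-! ### The reflection `f^#` and the functions `s_β` -/

theorem sharp_sharp (f : ℂ → ℂ) : sharp (sharp f) = f := by
  funext z; simp [sharp]

theorem differentiable_sharp {f : ℂ → ℂ} (hf : Differentiable ℂ f) : Differentiable ℂ (sharp f) :=
  fun z => (hf (conj z)).conj_conj |> fun h => by simpa [Function.comp_def, sharp] using! h

theorem norm_sharp (f : ℂ → ℂ) (z : ℂ) : ‖sharp f z‖ = ‖f (conj z)‖ := by simp [sharp]

theorem norm_sharp_ofReal (f : ℂ → ℂ) (x : ℝ) : ‖sharp f x‖ = ‖f x‖ := by simp [sharp]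

theorem IsHermiteBiehler.ne_zero {e : ℂ → ℂ} (he : IsHermiteBiehler e) (hr : ∀ x : ℝ, e x ≠ 0)
    {z : ℂ} (hz : 0 ≤ z.im) : e z ≠ 0 := by
  rcases hz.eq_or_lt with h | h
  · have : z = (z.re : ℂ) := Complex.ext (by simp) (by simp [← h])
    rw [this]; exact hr _
  · exact norm_pos_iff.1 ((norm_nonneg _).trans_lt (he.2 z h))

theorem IsHermiteBiehler.norm_sharp_le {e : ℂ → ℂ} (he : IsHermiteBiehler e) {z : ℂ}
    (hz : 0 ≤ z.im) : ‖sharp e z‖ ≤ ‖e z‖ := by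
  rw [norm_sharp]
  rcases hz.eq_or_lt with h | h
  · rw [Complex.conj_eq_iff_im.2 h.symm]
  · exact (he.2 z h).le

theorem differentiable_sFun {e : ℂ → ℂ} (he : Differentiable ℂ e) (β : ℝ) :
    Differentiable ℂ (sFun e β) := by
  have := differentiable_sharp he
  unfold sFun
  fun_prop

theorem conj_sFun (e : ℂ → ℂ) (β : ℝ) (z : ℂ) : conj (sFun e β (conj z)) = sFun e β z := by
  simp only [sFun, sharp, map_mul, map_sub, map_div₀, Complex.conj_I, ← Complex.exp_conj, map_neg,
    Complex.conj_ofReal, Complex.conj_conj, map_ofNat]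
  ring_nf

theorem sharp_sFun (e : ℂ → ℂ) (β : ℝ) : sharp (sFun e β) = sFun e β :=
  funext fun z => conj_sFun e β z

theorem norm_exp_I_mul (β : ℝ) : ‖Complex.exp (Complex.I * β)‖ = 1 := by
  rw [mul_comm]; exact Complex.norm_exp_ofReal_mul_I β

theorem norm_exp_neg_I_mul (β : ℝ) : ‖Complex.exp (-(Complex.I * β))‖ = 1 := by
  have := norm_exp_I_mul (-β)
  push_cast at this
  rwa [mul_neg] at this

theorem IsHermiteBiehler.norm_sFun_le {e : ℂ → ℂ} (he : IsHermiteBiehler e) (β : ℝ) {z : ℂ}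
    (hz : 0 ≤ z.im) : ‖sFun e β z‖ ≤ ‖e z‖ := by
  have h := norm_sub_le (Complex.exp (Complex.I * β) * e z)
    (Complex.exp (-(Complex.I * β)) * sharp e z)
  rw [norm_mul, norm_mul, norm_exp_I_mul, norm_exp_neg_I_mul] at h
  have h2 := he.norm_sharp_le hz
  rw [sFun, norm_mul, norm_div, Complex.norm_I, Complex.norm_ofNat]
  linarith

theorem IsHermiteBiehler.sFun_ne_zero {e : ℂ → ℂ} (he : IsHermiteBiehler e) (β : ℝ) {z : ℂ}
    (hz : z.im ≠ 0) : sFun e β z ≠ 0 := by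
  wlog hpos : 0 < z.im generalizing z
  · intro h
    refine this (z := conj z) (by simpa using hz) ?_ ?_
    · simpa using lt_of_le_of_ne (not_lt.1 hpos) hz
    · have := conj_sFun e β z
      rw [h] at this
      simpa using this
  intro h
  simp only [sFun, mul_eq_zero, div_eq_zero_iff, Complex.I_ne_zero, OfNat.ofNat_ne_zero,
    or_self, false_or, sub_eq_zero] at h
  have h2 := congrArg norm h
  rw [norm_mul, norm_mul, norm_exp_I_mul, norm_exp_neg_I_mul, norm_sharp, one_mul, one_mul] at h2
  exact (he.2 z hpos).ne' h2

theorem eq_ofReal_of_sFun_eq_zero {e : ℂ → ℂ} (he : IsHermiteBiehler e) {β : ℝ} {z : ℂ}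
    (hz : sFun e β z = 0) : z = (z.re : ℂ) := by
  refine Complex.ext (by simp) ?_
  by_contra h
  exact he.sFun_ne_zero β (by simpa using h) hz

/-- Elimination of `e^#` between `s_β` and `s_0`. Since `sin β ≠ 0` for `0 < β < π`, information on
these two functions becomes information on `e`. -/
theorem sFun_eq (e : ℂ → ℂ) (β : ℝ) (z : ℂ) :
    sFun e β z = Complex.exp (-(Complex.I * β)) * sFun e 0 z - Real.sin β * e z := by
  have h1 : Complex.exp (Complex.I * β) = Real.cos β + Real.sin β * Complex.I := by
    rw [mul_comm, Complex.exp_mul_I]; push_cast; ring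
  have h2 : Complex.exp (-(Complex.I * β)) = Real.cos β - Real.sin β * Complex.I := by
    rw [mul_comm, ← neg_mul, Complex.exp_mul_I, Complex.cos_neg, Complex.sin_neg]; push_cast; ring
  simp only [sFun, Complex.ofReal_zero, mul_zero, neg_zero, Complex.exp_zero, one_mul]
  rw [h1, h2]
  linear_combination (Real.sin β * e z : ℂ) * Complex.I_sq

theorem sin_ne_zero_of_mem {β : ℝ} (hβ : β ∈ Set.Ioo 0 Real.pi) : ((Real.sin β : ℝ) : ℂ) ≠ 0 :=
  Complex.ofReal_ne_zero.2 (Real.sin_pos_of_mem_Ioo hβ).ne'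

theorem continuousOn_div_hermiteBiehler {e f : ℂ → ℂ} (he : IsHermiteBiehler e)
    (hr : ∀ x : ℝ, e x ≠ 0) (hf : Differentiable ℂ f) :
    ContinuousOn (fun z => f z / e z) {z | 0 ≤ z.im} :=
  hf.continuous.continuousOn.div he.1.continuous.continuousOn fun _ hz => he.ne_zero hr hz

theorem differentiableOn_div_hermiteBiehler {e f : ℂ → ℂ} (he : IsHermiteBiehler e)
    (hf : Differentiable ℂ f) : DifferentiableOn ℂ (fun z => f z / e z) {z | 0 < z.im} :=
  hf.differentiableOn.div he.1.differentiableOn fun z hz =>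
    norm_pos_iff.1 ((norm_nonneg _).trans_lt (he.2 z hz))

/-! ### The embedding into `L_2(ℝ)` and point evaluations -/

theorem lineSq_zero_eq (F : ℂ → ℂ) : lineSq F 0 = ∫⁻ x : ℝ, ‖F x‖ₑ ^ 2 := by
  simp [lineSq]

theorem lineSq_sharp_zero (e f : ℂ → ℂ) :
    lineSq (fun z => sharp f z / e z) 0 = lineSq (fun z => f z / e z) 0 := by
  rw [lineSq_zero_eq, lineSq_zero_eq]
  refine lintegral_congr fun x => ?_
  rw [← ofReal_norm, ← ofReal_norm, norm_div, norm_div, norm_sharp_ofReal]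

theorem memLp_boundary {e : ℂ → ℂ} (he : IsHermiteBiehler e) (hr : ∀ x : ℝ, e x ≠ 0)
    (f : deBrangesSpace e) : MemLp (fun x : ℝ => (f : ℂ → ℂ) x / e x) 2 := by
  have hc := continuousOn_div_hermiteBiehler he hr f.2.1
  have hl := continuous_line hc le_rfl
  simp only [Complex.ofReal_zero, zero_mul, add_zero] at hl
  rw [memLp_two_iff_integrable_sq_norm hl.aestronglyMeasurable]
  obtain ⟨K, -, hK⟩ := exists_integral_norm_sq_le hc f.2.2.1
  simpa using (hK 0 le_rfl).1

/-- The isometric embedding of the de Branges space into `L_2(ℝ)` given by `f ↦ f / e`. -/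
noncomputable def toL2 {e : ℂ → ℂ} (he : IsHermiteBiehler e) (hr : ∀ x : ℝ, e x ≠ 0) :
    deBrangesSpace e →ₗ[ℂ] Lp ℂ 2 (volume : Measure ℝ) where
  toFun f := (memLp_boundary he hr f).toLp _
  map_add' f g := by
    rw [← MemLp.toLp_add]
    exact MemLp.toLp_congr _ _ (Eventually.of_forall fun x => by simp [add_div])
  map_smul' a f := by
    rw [← MemLp.toLp_const_smul]
    exact MemLp.toLp_congr _ _ (Eventually.of_forall fun x => by simp [mul_div_assoc])

theorem deBrangesNorm_eq {e : ℂ → ℂ} (he : IsHermiteBiehler e) (hr : ∀ x : ℝ, e x ≠ 0)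
    (f : deBrangesSpace e) : deBrangesNorm e f = ENNReal.ofReal ‖toL2 he hr f‖ := by
  change _ = ENNReal.ofReal ‖(memLp_boundary he hr f).toLp _‖
  rw [Lp.norm_toLp, ENNReal.ofReal_toReal (memLp_boundary he hr f).2.ne, deBrangesNorm]

theorem lineSq_eq_norm_toL2 {e : ℂ → ℂ} (he : IsHermiteBiehler e) (hr : ∀ x : ℝ, e x ≠ 0)
    (f : deBrangesSpace e) :
    lineSq (fun z => (f : ℂ → ℂ) z / e z) 0 = ENNReal.ofReal (‖toL2 he hr f‖ ^ 2) := by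
  rw [ENNReal.ofReal_pow (norm_nonneg _), ← deBrangesNorm_eq, deBrangesNorm, lineSq_zero_eq]
  have := eLpNorm_nnreal_pow_eq_lintegral (μ := volume) (p := 2)
    (f := fun x : ℝ => (f : ℂ → ℂ) x / e x) (by norm_num)
  simp only [NNReal.coe_ofNat, ENNReal.rpow_two] at this
  exact this.symm

theorem norm_mul_sqrt_le {e : ℂ → ℂ} (he : IsHermiteBiehler e) (hr : ∀ x : ℝ, e x ≠ 0)
    (f : deBrangesSpace e) {z : ℂ} (hz : 0 < z.im) :
    ‖(f : ℂ → ℂ) z‖ * Real.sqrt z.im ≤ 3 * ‖toL2 he hr f‖ * ‖e z‖ ∧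
      ‖(f : ℂ → ℂ) (conj z)‖ * Real.sqrt z.im ≤ 3 * ‖toL2 he hr f‖ * ‖e z‖ := by
  have hez := norm_pos_iff.2 (he.ne_zero hr hz.le)
  have h1 := norm_mul_sqrt_im_le (continuousOn_div_hermiteBiehler he hr f.2.1) f.2.2.1
    (norm_nonneg _) (lineSq_eq_norm_toL2 he hr f).le hz
  have h2 := norm_mul_sqrt_im_le
    (continuousOn_div_hermiteBiehler he hr (differentiable_sharp f.2.1)) f.2.2.2
    (norm_nonneg _) ((lineSq_sharp_zero e f).trans (lineSq_eq_norm_toL2 he hr f)).le hz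
  rw [norm_div, div_mul_eq_mul_div, div_le_iff₀ hez] at h1 h2
  rw [norm_sharp] at h2
  exact ⟨h1, h2⟩

/-- The Hardy bound blows up like `|Im z|^(-1/2)` at the real axis; `norm_le_of_norm_mul_im_sq_le`
on the circle of radius `2R` removes this singularity. -/
theorem exists_norm_le_toL2 {e : ℂ → ℂ} (he : IsHermiteBiehler e) (hr : ∀ x : ℝ, e x ≠ 0)
    {R : ℝ} (hR : 0 < R) : ∃ C : ℝ, 0 ≤ C ∧ ∀ f : deBrangesSpace e, ∀ z : ℂ, ‖z‖ ≤ R →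
      ‖(f : ℂ → ℂ) z‖ ≤ C * ‖toL2 he hr f‖ := by
  obtain ⟨E, hE⟩ := (isCompact_closedBall (0 : ℂ) (2 * R)).exists_bound_of_continuousOn
    he.1.continuous.continuousOn
  have hE0 : 0 ≤ E := (norm_nonneg _).trans (hE 0 (by simp [hR.le]))
  set A : ℝ := 3 * E * Real.sqrt (2 * R) * (2 * R)
  refine ⟨2 * A / R ^ 2, by positivity, fun f z hz => ?_⟩
  have key : ∀ z : ℂ, ‖z‖ = 2 * R → ‖(f : ℂ → ℂ) z‖ * z.im ^ 2 ≤ A * ‖toL2 he hr f‖ := by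
    intro z hz
    have hbound : ∀ a y : ℝ, 0 ≤ a → 0 ≤ y → y ≤ 2 * R →
        a * Real.sqrt y ≤ 3 * ‖toL2 he hr f‖ * E → a * y ^ 2 ≤ A * ‖toL2 he hr f‖ := by
      intro a y ha hy hyR h
      have h1 : y ^ 2 = Real.sqrt y * Real.sqrt y * y := by rw [Real.mul_self_sqrt hy, sq]
      have h2 : Real.sqrt y ≤ Real.sqrt (2 * R) := Real.sqrt_le_sqrt hyR
      calc a * y ^ 2 = (a * Real.sqrt y) * (Real.sqrt y * y) := by rw [h1]; ring
        _ ≤ (3 * ‖toL2 he hr f‖ * E) * (Real.sqrt (2 * R) * (2 * R)) := by gcongr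
        _ = _ := by simp only [A]; ring
    have him := Complex.abs_im_le_norm z
    rw [hz] at him
    rcases lt_trichotomy z.im 0 with h | h | h
    · have h' : 0 < (conj z).im := by simpa using h
      have h2 := (norm_mul_sqrt_le he hr f h').2
      rw [Complex.conj_conj] at h2
      have := hbound ‖(f : ℂ → ℂ) z‖ (conj z).im (norm_nonneg _) h'.le
        (by rw [Complex.conj_im]; exact (neg_le_abs _).trans him)
        (h2.trans (by gcongr; exact hE _ (by simp [hz])))
      simpa using this
    · rw [h]; simp; positivity
    · exact hbound ‖(f : ℂ → ℂ) z‖ z.im (norm_nonneg _) h.le ((le_abs_self _).trans him)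
        ((norm_mul_sqrt_le he hr f h).1.trans (by gcongr; exact hE _ (by simp [hz])))
  refine (norm_le_of_norm_mul_im_sq_le f.2.1 hR key hz).trans (le_of_eq ?_)
  ring

/-! ### Division by `z - w` in the de Branges space -/

theorem differentiable_dslope {P : ℂ → ℂ} (hP : Differentiable ℂ P) (w : ℂ) :
    Differentiable ℂ (dslope P w) :=
  differentiableOn_univ.1 ((Complex.differentiableOn_dslope univ_mem).2 hP.differentiableOn)

theorem sub_mul_dslope {P : ℂ → ℂ} {w : ℂ} (h0 : P w = 0) (z : ℂ) :
    (z - w) * dslope P w z = P z := by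
  have := sub_smul_dslope P w z
  rwa [h0, sub_zero, smul_eq_mul] at this

theorem eq_dslope_of_forall_ne {P g : ℂ → ℂ} {w : ℂ} (hP : Differentiable ℂ P) (hg : Continuous g)
    (h : ∀ z, z ≠ w → (z - w) * g z = P z) : g = dslope P w := by
  have h0 : P w = 0 := by
    have h1 : (fun z => (z - w) * g z) = P :=
      Continuous.ext_on (dense_compl_singleton w) (by fun_prop) hP.continuous fun z hz => h z hz
    simpa using (congrFun h1 w).symm
  refine Continuous.ext_on (dense_compl_singleton w) hg (differentiable_dslope hP w).continuous
    fun z hz => mul_left_cancel₀ (sub_ne_zero.2 hz) ?_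
  rw [sub_mul_dslope h0, h z hz]

theorem sharp_dslope {P : ℂ → ℂ} (hP : Differentiable ℂ P) {w : ℂ} (h0 : P w = 0) :
    sharp (dslope P w) = dslope (sharp P) (conj w) := by
  refine eq_dslope_of_forall_ne (differentiable_sharp hP)
    (differentiable_sharp (differentiable_dslope hP w)).continuous fun z _ => ?_
  have := sub_mul_dslope h0 (conj z)
  simp only [sharp]
  rw [← this]
  simp

/-- Used with `a = |P/((z - w)e)|`, `p = |f/e|` and `b` a bound for the multiple of `s_β/e`. Near
`w` the local bound `M` applies; farther away, division by the distance makes the bounded term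
square-integrable. Either way the extra term is a multiple of a Lorentzian. -/
theorem sq_le_of_mul_norm_sub_le {x y a p b M : ℝ} {w : ℂ} (ha : 0 ≤ a)
    (h1 : ‖(x : ℂ) + (y : ℂ) * Complex.I - w‖ ≤ 1 → a ≤ M)
    (h2 : a * ‖(x : ℂ) + (y : ℂ) * Complex.I - w‖ ≤ p + b) :
    a ^ 2 ≤ 2 * p ^ 2 + (4 * b ^ 2 + 2 * M ^ 2) * ((x - w.re) ^ 2 + 1 ^ 2)⁻¹ := by
  set d := ‖(x : ℂ) + (y : ℂ) * Complex.I - w‖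
  have hd0 : 0 ≤ d := norm_nonneg _
  have hxd : (x - w.re) ^ 2 ≤ d ^ 2 := by
    have := Complex.abs_re_le_norm ((x : ℂ) + (y : ℂ) * Complex.I - w)
    rw [← sq_abs (x - w.re)]
    simp at this
    gcongr
  have hs : 0 < (x - w.re) ^ 2 + 1 ^ 2 := by positivity
  rw [← sub_le_iff_le_add', ← div_eq_mul_inv, le_div_iff₀ hs]
  rcases le_or_gt d 1 with hd | hd
  · have hM := h1 hd
    have h3 : a ^ 2 ≤ M ^ 2 := by gcongr
    have h4 : (x - w.re) ^ 2 + 1 ^ 2 ≤ 2 := by nlinarith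
    have h5 : (a ^ 2 - 2 * p ^ 2) * ((x - w.re) ^ 2 + 1 ^ 2) ≤
        M ^ 2 * ((x - w.re) ^ 2 + 1 ^ 2) :=
      mul_le_mul_of_nonneg_right (by nlinarith [sq_nonneg p]) hs.le
    nlinarith [sq_nonneg M, sq_nonneg b, mul_nonneg (sq_nonneg M) (sub_nonneg.2 h4)]
  · have h3 : a ^ 2 * d ^ 2 ≤ 2 * p ^ 2 + 2 * b ^ 2 := by
      have : (a * d) ^ 2 ≤ (p + b) ^ 2 := by gcongr
      nlinarith [sq_nonneg (p - b)]
    have h4 : (x - w.re) ^ 2 + 1 ^ 2 ≤ 2 * d ^ 2 := by nlinarith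
    have hd2 : 1 ≤ d ^ 2 := by nlinarith
    by_cases hneg : a ^ 2 - 2 * p ^ 2 ≤ 0
    · nlinarith [mul_nonneg (sub_nonneg.2 hneg) hs.le, sq_nonneg b, sq_nonneg M]
    · have h5 : (a ^ 2 - 2 * p ^ 2) * ((x - w.re) ^ 2 + 1 ^ 2) ≤
          (a ^ 2 - 2 * p ^ 2) * (2 * d ^ 2) :=
        mul_le_mul_of_nonneg_left h4 (not_le.1 hneg).le
      nlinarith [mul_nonneg (sq_nonneg p) (sub_nonneg.2 hd2), sq_nonneg M]

theorem lintegral_sq_le_of_forall_le {H G : ℝ → ℂ} {c u : ℝ} (hc : 0 ≤ c)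
    (h : ∀ x, ‖H x‖ ^ 2 ≤ 2 * ‖G x‖ ^ 2 + c * ((x - u) ^ 2 + 1 ^ 2)⁻¹) :
    ∫⁻ x, ‖H x‖ₑ ^ 2 ≤ (2 * ∫⁻ x, ‖G x‖ₑ ^ 2) + ENNReal.ofReal (c * Real.pi) := by
  have hi := (integrable_inv_sq_add_sq u one_pos).1.const_mul c
  calc ∫⁻ x, ‖H x‖ₑ ^ 2
      ≤ ∫⁻ x, (2 * ‖G x‖ₑ ^ 2 + ENNReal.ofReal (c * ((x - u) ^ 2 + 1 ^ 2)⁻¹)) := by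
        refine lintegral_mono fun x => ?_
        rw [← ofReal_norm, ← ofReal_norm, ← ENNReal.ofReal_pow (norm_nonneg _),
          ← ENNReal.ofReal_pow (norm_nonneg _), ← ENNReal.ofReal_ofNat 2,
          ← ENNReal.ofReal_mul (by norm_num), ← ENNReal.ofReal_add (by positivity) (by positivity)]
        exact ENNReal.ofReal_le_ofReal (h x)
    _ = (2 * ∫⁻ x, ‖G x‖ₑ ^ 2) + ENNReal.ofReal (c * Real.pi) := by
        rw [lintegral_add_right' _ hi.1.aemeasurable.ennreal_ofReal,
          lintegral_const_mul' _ _ (by norm_num),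
          ← ofReal_integral_eq_lintegral_ofReal hi (Eventually.of_forall fun x => by positivity),
          integral_const_mul, (integrable_inv_sq_add_sq u one_pos).2, div_one]

theorem memHardyTwo_dslope_div {e P f : ℂ → ℂ} (he : IsHermiteBiehler e) (hr : ∀ x : ℝ, e x ≠ 0)
    (hP : Differentiable ℂ P) {w : ℂ} (h0 : P w = 0) (hf : MemHardyTwo fun z => f z / e z) {b : ℝ}
    (hle : ∀ z : ℂ, 0 < z.im → ‖P z‖ ≤ ‖f z‖ + b * ‖e z‖) :
    MemHardyTwo fun z => dslope P w z / e z := by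
  have hD := differentiable_dslope hP w
  refine ⟨differentiableOn_div_hermiteBiehler he hD, ?_⟩
  obtain ⟨C, hC⟩ := hf.2
  -- The disc is cut to the closed upper half-plane because `e` may vanish below the real axis.
  obtain ⟨M, hM⟩ := ((isCompact_closedBall w 1).inter_right
    (isClosed_le continuous_const Complex.continuous_im)).exists_bound_of_continuousOn
    ((continuousOn_div_hermiteBiehler he hr hD).mono Set.inter_subset_right)
  have hc : 0 ≤ 4 * b ^ 2 + 2 * M ^ 2 := by positivity
  refine ⟨2 * C + Real.toNNReal ((4 * b ^ 2 + 2 * M ^ 2) * Real.pi), fun y hy => ?_⟩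
  refine (lintegral_sq_le_of_forall_le (G := fun x : ℝ => f ((x : ℂ) + (y : ℂ) * Complex.I) /
    e ((x : ℂ) + (y : ℂ) * Complex.I)) (u := w.re) hc fun x => ?_).trans ?_
  · have hz : 0 < ((x : ℂ) + (y : ℂ) * Complex.I).im := by rw [im_line]; exact hy
    set z := (x : ℂ) + (y : ℂ) * Complex.I
    have hez := norm_pos_iff.2 (he.ne_zero hr hz.le)
    refine sq_le_of_mul_norm_sub_le (y := y) (norm_nonneg _) (fun h => ?_) ?_
    · exact hM z ⟨by simpa [dist_eq_norm] using h, hz.le⟩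
    · change ‖dslope P w z / e z‖ * ‖z - w‖ ≤ ‖f z / e z‖ + b
      rw [norm_div, norm_div, div_mul_eq_mul_div, ← norm_mul, mul_comm (dslope P w z),
        sub_mul_dslope h0, div_add' _ _ _ hez.ne']
      gcongr
      exact hle z hz
  · push_cast
    have := hC y hy
    gcongr
    rfl

/-- If `f + b s_β` vanishes at `w`, with `f` in the de Branges space, then its quotient by `z - w`
belongs to the de Branges space. -/
theorem dslope_mem {e f : ℂ → ℂ} (he : IsHermiteBiehler e) (hr : ∀ x : ℝ, e x ≠ 0)
    (hf : f ∈ deBrangesSpace e) (b : ℂ) (β : ℝ) {w : ℂ} (h0 : f w + b * sFun e β w = 0) :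
    dslope (fun z => f z + b * sFun e β z) w ∈ deBrangesSpace e := by
  set P : ℂ → ℂ := fun z => f z + b * sFun e β z
  have hP : Differentiable ℂ P := hf.1.add ((differentiable_sFun he.1 β).const_mul b)
  refine ⟨differentiable_dslope hP w, ?_, ?_⟩
  · refine memHardyTwo_dslope_div he hr hP h0 hf.2.1 (b := ‖b‖) fun z hz => ?_
    refine (norm_add_le _ _).trans ?_
    rw [norm_mul]
    gcongr
    exact he.norm_sFun_le β hz.le
  · rw [sharp_dslope hP h0]
    refine memHardyTwo_dslope_div he hr (differentiable_sharp hP) (by simp [sharp, h0, P])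
      hf.2.2 (b := ‖b‖) fun z hz => ?_
    have : sharp P z = sharp f z + conj b * sFun e β z := by
      simp only [sharp, P, map_add, map_mul, conj_sFun]
    rw [this]
    refine (norm_add_le _ _).trans ?_
    rw [norm_mul, RCLike.norm_conj]
    gcongr
    exact he.norm_sFun_le β hz.le

/-! ### The orthogonal system `s_β(z) / (z - w)` -/

theorem sFun_zero_ne_zero {e : ℂ → ℂ} (he : IsHermiteBiehler e) (hr : ∀ x : ℝ, e x ≠ 0) {β : ℝ}
    (hβ : β ∈ Set.Ioo 0 Real.pi) {w : ℂ} (hw : sFun e β w = 0) : sFun e 0 w ≠ 0 := by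
  intro h
  have h1 := sFun_eq e β w
  rw [hw, h, mul_zero, zero_sub, eq_comm, neg_eq_zero, mul_eq_zero] at h1
  have h2 := h1.resolve_left (sin_ne_zero_of_mem hβ)
  rw [eq_ofReal_of_sFun_eq_zero he hw] at h2
  exact hr _ h2

theorem toL2_inner {e : ℂ → ℂ} (he : IsHermiteBiehler e) (hr : ∀ x : ℝ, e x ≠ 0)
    (a f : deBrangesSpace e) : inner ℂ (toL2 he hr a) (toL2 he hr f) =
      ∫ x : ℝ, (f : ℂ → ℂ) x / e x * conj ((a : ℂ → ℂ) x / e x) := by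
  rw [L2.inner_def]
  refine integral_congr_ae ?_
  filter_upwards [(memLp_boundary he hr a).coeFn_toLp, (memLp_boundary he hr f).coeFn_toLp]
    with x h1 h2
  change inner ℂ ((memLp_boundary he hr a).toLp _ x) ((memLp_boundary he hr f).toLp _ x) = _
  rw [h1, h2, RCLike.inner_apply]

/-- On the real line `s_γ` is a combination of `e` and `conj e`, so the integrand is a combination
of `m/e` and `conj (m^#/e)`. Both integrals vanish by Cauchy's theorem, as `(z - u)m` is also in the
space. -/
theorem integral_mul_sFun_eq_zero {e : ℂ → ℂ} (he : IsHermiteBiehler e) (hr : ∀ x : ℝ, e x ≠ 0)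
    (m n : deBrangesSpace e) (u : ℝ) (hn : ∀ z, (n : ℂ → ℂ) z = (z - u) * (m : ℂ → ℂ) z) (γ : ℝ) :
    ∫ x : ℝ, (m : ℂ → ℂ) x * sFun e γ x / (e x * conj (e x)) = 0 := by
  obtain ⟨hi1, h1⟩ := integrable_and_integral_eq_zero_of_memHardyTwo (u := u)
    (continuousOn_div_hermiteBiehler he hr m.2.1) m.2.2.1
    (by simpa only [hn, mul_div_assoc] using n.2.2.1)
  have hns : ∀ z, sharp n z = (z - u) * sharp m z := fun z => by simp [sharp, hn]
  obtain ⟨hi2, h2⟩ := integrable_and_integral_eq_zero_of_memHardyTwo (u := u)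
    (continuousOn_div_hermiteBiehler he hr (differentiable_sharp m.2.1)) m.2.2.2
    (by simpa only [hns, mul_div_assoc] using n.2.2.2)
  have heq : ∀ x : ℝ, (m : ℂ → ℂ) x * sFun e γ x / (e x * conj (e x)) =
      Complex.I / 2 * Complex.exp (Complex.I * γ) * conj (sharp m x / e x) -
        Complex.I / 2 * Complex.exp (-(Complex.I * γ)) * ((m : ℂ → ℂ) x / e x) := by
    intro x
    have hx := hr x
    have hx' : conj (e x) ≠ 0 := by simpa using hx
    simp only [sFun, sharp, Complex.conj_ofReal, map_div₀, Complex.conj_conj]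
    field_simp
  have hi2' : Integrable fun x : ℝ => conj (sharp m x / e x) :=
    (Complex.conjCLE.toContinuousLinearMap.integrable_comp hi2 :)
  simp_rw [heq]
  rw [integral_sub (hi2'.const_mul _) (hi1.const_mul _), integral_const_mul, integral_const_mul, h1,
    integral_conj, h2]
  simp

theorem dslope_sFun_mem {e : ℂ → ℂ} (he : IsHermiteBiehler e) (hr : ∀ x : ℝ, e x ≠ 0) {β : ℝ}
    {w : ℂ} (hw : sFun e β w = 0) : dslope (sFun e β) w ∈ deBrangesSpace e := by
  have := dslope_mem he hr (zero_mem _) 1 β (w := w) (by simp [hw])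
  simpa using this

/-- The function `s_β(z) / (z - w)` attached to a zero `w` of `s_β`. -/
noncomputable def sKernel {e : ℂ → ℂ} (he : IsHermiteBiehler e) (hr : ∀ x : ℝ, e x ≠ 0) {β : ℝ}
    {w : ℂ} (hw : sFun e β w = 0) : deBrangesSpace e :=
  ⟨dslope (sFun e β) w, dslope_sFun_mem he hr hw⟩

theorem sub_mul_sKernel {e : ℂ → ℂ} (he : IsHermiteBiehler e) (hr : ∀ x : ℝ, e x ≠ 0) {β : ℝ}
    {w : ℂ} (hw : sFun e β w = 0) (z : ℂ) : (z - w) * (sKernel he hr hw : ℂ → ℂ) z = sFun e β z :=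
  sub_mul_dslope hw z

theorem sKernel_self {e : ℂ → ℂ} (he : IsHermiteBiehler e) (hr : ∀ x : ℝ, e x ≠ 0) {β : ℝ}
    {w : ℂ} (hw : sFun e β w = 0) : (sKernel he hr hw : ℂ → ℂ) w = deriv (sFun e β) w :=
  dslope_same _ _

theorem sKernel_of_ne {e : ℂ → ℂ} (he : IsHermiteBiehler e) (hr : ∀ x : ℝ, e x ≠ 0) {β : ℝ}
    {w v : ℂ} (hw : sFun e β w = 0) (hv : sFun e β v = 0) (hne : v ≠ w) :
    (sKernel he hr hw : ℂ → ℂ) v = 0 := by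
  have := sub_mul_sKernel he hr hw v
  rw [hv, mul_eq_zero] at this
  exact this.resolve_left (sub_ne_zero.2 hne)

theorem conj_sKernel_ofReal {e : ℂ → ℂ} (he : IsHermiteBiehler e) (hr : ∀ x : ℝ, e x ≠ 0) {β : ℝ}
    {w : ℂ} (hw : sFun e β w = 0) (x : ℝ) :
    conj ((sKernel he hr hw : ℂ → ℂ) x) = (sKernel he hr hw : ℂ → ℂ) x := by
  have h := sharp_dslope (differentiable_sFun he.1 β) hw
  rw [sharp_sFun, eq_ofReal_of_sFun_eq_zero he hw, Complex.conj_ofReal,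
    ← eq_ofReal_of_sFun_eq_zero he hw] at h
  have h1 := congrFun h x
  simp only [sharp, Complex.conj_ofReal] at h1
  exact h1

theorem eq_zero_of_toL2_eq_zero {e : ℂ → ℂ} (he : IsHermiteBiehler e) (hr : ∀ x : ℝ, e x ≠ 0)
    {f : deBrangesSpace e} (hf : toL2 he hr f = 0) (z : ℂ) : (f : ℂ → ℂ) z = 0 := by
  obtain ⟨C, -, hC⟩ := exists_norm_le_toL2 he hr (R := ‖z‖ + 1) (by positivity)
  have := hC f z (by linarith)
  rw [hf, norm_zero, mul_zero] at this
  exact norm_le_zero_iff.1 this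

theorem toL2_sKernel_ne_zero {e : ℂ → ℂ} (he : IsHermiteBiehler e) (hr : ∀ x : ℝ, e x ≠ 0) {β : ℝ}
    {w : ℂ} (hw : sFun e β w = 0) : toL2 he hr (sKernel he hr hw) ≠ 0 := by
  intro h
  have := sub_mul_sKernel he hr hw Complex.I
  rw [eq_zero_of_toL2_eq_zero he hr h, mul_zero] at this
  exact he.sFun_ne_zero β (by simp) this.symm

/-- The combination `n = s_β'(w) f - f(w) k_w` vanishes at `w`, so `n = (z - w)m` with `m` in the
space. As `(x - w) k_w = s_β`, the product `⟨k_w, n⟩` is `∫ m s_β/|e|² = 0`. -/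
theorem mul_inner_sKernel {e : ℂ → ℂ} (he : IsHermiteBiehler e) (hr : ∀ x : ℝ, e x ≠ 0) {β : ℝ}
    {w : ℂ} (hw : sFun e β w = 0) (f : deBrangesSpace e) :
    deriv (sFun e β) w * inner ℂ (toL2 he hr (sKernel he hr hw)) (toL2 he hr f) =
      (f : ℂ → ℂ) w * inner ℂ (toL2 he hr (sKernel he hr hw)) (toL2 he hr (sKernel he hr hw)) := by
  set k := sKernel he hr hw
  set n : deBrangesSpace e := deriv (sFun e β) w • f - (f : ℂ → ℂ) w • k
  have hnw : (n : ℂ → ℂ) w = 0 := by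
    have hkw : (k : ℂ → ℂ) w = deriv (sFun e β) w := sKernel_self he hr hw
    simp only [n, Submodule.coe_sub, Submodule.coe_smul, Pi.sub_apply, Pi.smul_apply, smul_eq_mul,
      hkw]
    ring
  have hmem := dslope_mem he hr n.2 0 β (w := w) (by simp [hnw])
  simp only [zero_mul, add_zero] at hmem
  have hz := integral_mul_sFun_eq_zero he hr ⟨_, hmem⟩ n w.re (fun z => by
    rw [← eq_ofReal_of_sFun_eq_zero he hw]; exact (sub_mul_dslope hnw z).symm) β
  have h0 : inner ℂ (toL2 he hr k) (toL2 he hr n) = 0 := by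
    rw [toL2_inner, ← hz]
    refine integral_congr_ae (Eventually.of_forall fun x => ?_)
    simp only
    rw [map_div₀, conj_sKernel_ofReal, ← sub_mul_sKernel he hr hw, ← sub_mul_dslope hnw]
    ring
  simp only [n, map_sub, map_smul, inner_sub_right, inner_smul_right] at h0
  exact sub_eq_zero.1 h0

/-- A double zero would give `s_0(w) ‖k_w‖² = 0` by `mul_inner_sKernel`, but neither factor
vanishes. -/
theorem deriv_sFun_ne_zero {e : ℂ → ℂ} (he : IsHermiteBiehler e) (hr : ∀ x : ℝ, e x ≠ 0)
    (h0 : sFun e 0 ∈ deBrangesSpace e) {β : ℝ} (hβ : β ∈ Set.Ioo 0 Real.pi)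
    {w : ℂ} (hw : sFun e β w = 0) : deriv (sFun e β) w ≠ 0 := by
  intro h
  have := mul_inner_sKernel he hr hw ⟨_, h0⟩
  rw [h, zero_mul, eq_comm, mul_eq_zero, inner_self_eq_zero] at this
  exact this.elim (sFun_zero_ne_zero he hr hβ hw) (toL2_sKernel_ne_zero he hr hw)

theorem inner_sKernel_eq_zero {e : ℂ → ℂ} (he : IsHermiteBiehler e) (hr : ∀ x : ℝ, e x ≠ 0)
    (h0 : sFun e 0 ∈ deBrangesSpace e) {β : ℝ} (hβ : β ∈ Set.Ioo 0 Real.pi)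
    {w v : ℂ} (hw : sFun e β w = 0) (hv : sFun e β v = 0) (hne : w ≠ v) :
    inner ℂ (toL2 he hr (sKernel he hr hw)) (toL2 he hr (sKernel he hr hv)) = 0 := by
  have := mul_inner_sKernel he hr hw (sKernel he hr hv)
  rw [sKernel_of_ne he hr hv hw hne, zero_mul, mul_eq_zero] at this
  exact this.resolve_left (deriv_sFun_ne_zero he hr h0 hβ hw)

/-- Since `(z - v)(k_w - k_v) = (w - v) k_w` lies in the space, the difference integrates to zero
against `s_0`. -/
theorem inner_sKernel_sFun_zero_eq {e : ℂ → ℂ} (he : IsHermiteBiehler e) (hr : ∀ x : ℝ, e x ≠ 0)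
    (h0 : sFun e 0 ∈ deBrangesSpace e) {β : ℝ} {w v : ℂ} (hw : sFun e β w = 0)
    (hv : sFun e β v = 0) :
    inner ℂ (toL2 he hr (sKernel he hr hw)) (toL2 he hr ⟨_, h0⟩) =
      inner ℂ (toL2 he hr (sKernel he hr hv)) (toL2 he hr ⟨_, h0⟩) := by
  have hz := integral_mul_sFun_eq_zero he hr (sKernel he hr hw - sKernel he hr hv)
    ((w - v) • sKernel he hr hw) v.re (fun z => by
      rw [← eq_ofReal_of_sFun_eq_zero he hv]
      simp only [Submodule.coe_sub, Submodule.coe_smul, Pi.sub_apply, Pi.smul_apply, smul_eq_mul]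
      linear_combination sub_mul_sKernel he hr hv z - sub_mul_sKernel he hr hw z) 0
  rw [← sub_eq_zero, ← inner_sub_left, ← map_sub, toL2_inner, ← hz]
  refine integral_congr_ae (Eventually.of_forall fun x => ?_)
  simp only [Submodule.coe_sub, Pi.sub_apply, map_div₀, map_sub, conj_sKernel_ofReal]
  ring

/-- `mul_inner_sKernel` applied to `s_0`; the constant is `|⟨k_v, s_0⟩|` for any one zero `v`, and
is arbitrary if there are no zeros. -/
theorem exists_norm_sq_sKernel_eq {e : ℂ → ℂ} (he : IsHermiteBiehler e) (hr : ∀ x : ℝ, e x ≠ 0)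
    (h0 : sFun e 0 ∈ deBrangesSpace e) {β : ℝ} (hβ : β ∈ Set.Ioo 0 Real.pi) :
    ∃ D : ℝ, 0 < D ∧ ∀ (w : ℂ) (hw : sFun e β w = 0),
      ‖toL2 he hr (sKernel he hr hw)‖ ^ 2 = D * ‖deriv (sFun e β) w / sFun e 0 w‖ := by
  by_cases hex : ∃ v, sFun e β v = 0
  swap
  · push Not at hex
    exact ⟨1, one_pos, fun w hw => absurd hw (hex w)⟩
  obtain ⟨v, hv⟩ := hex
  set d : ℂ := inner ℂ (toL2 he hr (sKernel he hr hv)) (toL2 he hr ⟨_, h0⟩)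
  have key : ∀ (w : ℂ) (hw : sFun e β w = 0),
      ‖toL2 he hr (sKernel he hr hw)‖ ^ 2 = ‖d‖ * ‖deriv (sFun e β) w / sFun e 0 w‖ := by
    intro w hw
    have h1 := congrArg norm (mul_inner_sKernel he hr hw ⟨_, h0⟩)
    rw [inner_sKernel_sFun_zero_eq he hr h0 hw hv, inner_self_eq_norm_sq_to_K, norm_mul, norm_mul,
      norm_pow] at h1
    simp only [Complex.coe_algebraMap, Complex.norm_real, norm_norm] at h1
    have h2 := norm_pos_iff.2 (sFun_zero_ne_zero he hr hβ hw)
    rw [norm_div, mul_div_assoc', eq_div_iff h2.ne', mul_comm ‖d‖, h1, mul_comm]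
  refine ⟨‖d‖, norm_pos_iff.2 fun hd => ?_, key⟩
  have := key v hv
  rw [hd, norm_zero, zero_mul, sq_eq_zero_iff, norm_eq_zero] at this
  exact toL2_sKernel_ne_zero he hr hv this

/-! ### Uniqueness from the zeros of `s_β` -/

/-- With `a = exp(iβ) e` and `b = exp(-iβ) e^#`, the inequality `|b| < |a|` gives `(a + b)/(a - b)`
positive real part, hence polynomial growth; and `2a` is `a - b` times one plus this quotient. -/
theorem exists_norm_mul_im_le_norm_sFun {e : ℂ → ℂ} (he : IsHermiteBiehler e) (β : ℝ) :
    ∃ C : ℝ, 0 ≤ C ∧ ∀ z : ℂ, 0 < z.im → ‖e z‖ * z.im ≤ C * (1 + ‖z‖) ^ 2 * ‖sFun e β z‖ := by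
  set a : ℂ → ℂ := fun z => Complex.exp (Complex.I * β) * e z
  set b : ℂ → ℂ := fun z => Complex.exp (-(Complex.I * β)) * sharp e z
  have hs : ∀ z, ‖a z - b z‖ = 2 * ‖sFun e β z‖ := fun z => by
    rw [sFun, norm_mul, norm_div, Complex.norm_I, Complex.norm_ofNat]; ring
  have hne : ∀ z : ℂ, 0 < z.im → a z - b z ≠ 0 := fun z hz => by
    rw [← norm_pos_iff, hs]
    have := norm_pos_iff.2 (he.sFun_ne_zero β hz.ne')
    positivity
  have hna : ∀ z, ‖a z‖ = ‖e z‖ := fun z => by simp only [a, norm_mul, norm_exp_I_mul, one_mul]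
  have hnb : ∀ z, ‖b z‖ = ‖e (conj z)‖ := fun z => by
    simp only [b, norm_mul, norm_exp_neg_I_mul, one_mul, norm_sharp]
  have hda : Differentiable ℂ a := he.1.const_mul _
  have hdb : Differentiable ℂ b := (differentiable_sharp he.1).const_mul _
  obtain ⟨C, hC0, hC⟩ := exists_norm_le_of_re_pos (H := fun z => (a z + b z) / (a z - b z))
    ((hda.add hdb).differentiableOn.div (hda.sub hdb).differentiableOn hne) (fun z hz => by
      have h1 : ‖b z‖ < ‖a z‖ := by rw [hna, hnb]; exact he.2 z hz
      have h2 : ((a z + b z) / (a z - b z)).re =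
          (‖a z‖ ^ 2 - ‖b z‖ ^ 2) / Complex.normSq (a z - b z) := by
        rw [← Complex.normSq_eq_norm_sq, ← Complex.normSq_eq_norm_sq, Complex.div_re, ← add_div,
          Complex.normSq_apply (a z), Complex.normSq_apply (b z)]
        simp only [Complex.add_re, Complex.sub_re, Complex.add_im, Complex.sub_im]
        ring
      rw [h2]
      have := Complex.normSq_pos.2 (hne z hz)
      have : 0 < ‖a z‖ ^ 2 - ‖b z‖ ^ 2 := by nlinarith [norm_nonneg (b z)]
      positivity)
  refine ⟨1 + C, by positivity, fun z hz => ?_⟩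
  have h1 : a z * 2 = (1 + (a z + b z) / (a z - b z)) * (a z - b z) := by
    have := hne z hz
    field_simp
    ring
  have h2 : ‖e z‖ ≤ (1 + ‖(a z + b z) / (a z - b z)‖) * ‖sFun e β z‖ := by
    have h3 := congrArg norm h1
    rw [norm_mul (a z), norm_mul _ (a z - b z), hna, hs, Complex.norm_ofNat] at h3
    have h4 := norm_add_le 1 ((a z + b z) / (a z - b z))
    rw [norm_one] at h4
    nlinarith [mul_le_mul_of_nonneg_right h4 (norm_nonneg (sFun e β z))]
  have h5 : z.im ≤ (1 + ‖z‖) ^ 2 := by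
    have := (le_abs_self _).trans (Complex.abs_im_le_norm z)
    nlinarith [norm_nonneg z]
  calc ‖e z‖ * z.im ≤ (1 + ‖(a z + b z) / (a z - b z)‖) * ‖sFun e β z‖ * z.im := by gcongr
    _ = (z.im + ‖(a z + b z) / (a z - b z)‖ * z.im) * ‖sFun e β z‖ := by ring
    _ ≤ ((1 + ‖z‖) ^ 2 + C * (1 + ‖z‖) ^ 2) * ‖sFun e β z‖ :=
        mul_le_mul_of_nonneg_right (add_le_add h5 (hC z hz)) (norm_nonneg _)
    _ = _ := by ring

/-- Division of entire functions by an entire function with simple zeros. -/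
theorem exists_entire_mul_eq {F S : ℂ → ℂ} (hF : Differentiable ℂ F) (hS : Differentiable ℂ S)
    (h : ∀ w, S w = 0 → F w = 0 ∧ deriv S w ≠ 0) :
    ∃ q : ℂ → ℂ, Differentiable ℂ q ∧ ∀ z, q z * S z = F z := by
  classical
  refine ⟨fun z => if S z = 0 then deriv F z / deriv S z else F z / S z, fun w => ?_, fun z => ?_⟩
  · by_cases hw : S w = 0
    · obtain ⟨hFw, hS'⟩ := h w hw
      have hd : dslope S w w ≠ 0 := by rwa [dslope_same]
      have hcS := (differentiable_dslope hS w).continuous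
      have hev : ∀ᶠ z in 𝓝 w, dslope S w z ≠ 0 := hcS.continuousAt.eventually_ne hd
      refine (((differentiable_dslope hF w) w).div ((differentiable_dslope hS w) w)
        hd).congr_of_eventuallyEq ?_
      filter_upwards [hev] with z hz
      rcases eq_or_ne z w with rfl | hzw
      · simp [hw]
      · have hSz : S z ≠ 0 := by
          rw [← sub_mul_dslope hw z]; exact mul_ne_zero (sub_ne_zero.2 hzw) hz
        simp only [hSz, if_false, Pi.div_apply]
        rw [← sub_mul_dslope hw z, ← sub_mul_dslope hFw z,
          mul_div_mul_left _ _ (sub_ne_zero.2 hzw)]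
    · have hev : ∀ᶠ z in 𝓝 w, S z ≠ 0 := hS.continuous.continuousAt.eventually_ne hw
      refine ((hF w).div (hS w) hw).congr_of_eventuallyEq ?_
      filter_upwards [hev] with z hz
      simp [hz]
  · by_cases hz : S z = 0
    · simp [hz, (h z hz).1]
    · simp [hz]

/-- An entire function with the pointwise bounds of an element of the de Branges space is
determined by its values at the zeros of `s_β`. -/
theorem eq_zero_of_vanishing_on_zeros {e : ℂ → ℂ} (he : IsHermiteBiehler e)
    (hr : ∀ x : ℝ, e x ≠ 0) (h0 : sFun e 0 ∈ deBrangesSpace e) {β : ℝ}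
    (hβ : β ∈ Set.Ioo 0 Real.pi) {F : ℂ → ℂ} (hF : Differentiable ℂ F) {C : ℝ}
    (hC : ∀ z : ℂ, 0 < z.im → ‖F z‖ * Real.sqrt z.im ≤ C * ‖e z‖ ∧
      ‖F (conj z)‖ * Real.sqrt z.im ≤ C * ‖e z‖)
    (hz : ∀ w, sFun e β w = 0 → F w = 0) (z : ℂ) : F z = 0 := by
  obtain ⟨q, hq, hqF⟩ := exists_entire_mul_eq hF (differentiable_sFun he.1 β)
    fun w hw => ⟨hz w hw, deriv_sFun_ne_zero he hr h0 hβ hw⟩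
  obtain ⟨A, hA0, hA⟩ := exists_norm_mul_im_le_norm_sFun he β
  have hC0 : 0 ≤ C := by
    have h1 := (hC Complex.I (by simp)).1
    have h2 := norm_pos_iff.2 (he.ne_zero hr (z := Complex.I) (by simp))
    exact nonneg_of_mul_nonneg_left (le_trans (by positivity) h1) h2
  have hmain : ∀ (z : ℂ) (t : ℝ), 0 < z.im → 0 ≤ t →
      t * ‖sFun e β z‖ * Real.sqrt z.im ≤ C * ‖e z‖ →
      t * z.im ^ 2 ≤ A * C * (1 + ‖z‖) ^ 2 * Real.sqrt z.im := by
    intro z t hy ht h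
    have hez := norm_pos_iff.2 (he.ne_zero hr hy.le)
    refine le_of_mul_le_mul_right ?_ hez
    have hs := Real.mul_self_sqrt hy.le
    calc t * z.im ^ 2 * ‖e z‖ = t * (‖e z‖ * z.im) * z.im := by ring
      _ ≤ t * (A * (1 + ‖z‖) ^ 2 * ‖sFun e β z‖) * z.im :=
        mul_le_mul_of_nonneg_right (mul_le_mul_of_nonneg_left (hA z hy) ht) hy.le
      _ = A * (1 + ‖z‖) ^ 2 * Real.sqrt z.im * (t * ‖sFun e β z‖ * Real.sqrt z.im) := by
        nth_rewrite 1 [← hs]; ring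
      _ ≤ A * (1 + ‖z‖) ^ 2 * Real.sqrt z.im * (C * ‖e z‖) := by gcongr
      _ = _ := by ring
  have hqb : ∀ z : ℂ, ‖q z‖ * z.im ^ 2 ≤ A * C * (1 + ‖z‖) ^ 2 * Real.sqrt ‖z‖ := by
    intro z
    have hsq : Real.sqrt |z.im| ≤ Real.sqrt ‖z‖ := Real.sqrt_le_sqrt (Complex.abs_im_le_norm z)
    refine le_trans ?_ (mul_le_mul_of_nonneg_left hsq (by positivity))
    rcases lt_trichotomy z.im 0 with h | h | h
    · have h' : 0 < (conj z).im := by simpa using h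
      have := hmain (conj z) ‖q z‖ h' (norm_nonneg _) (by
        have h1 := (hC _ h').2
        rw [Complex.conj_conj, ← hqF z, norm_mul] at h1
        rwa [← RCLike.norm_conj (sFun e β (conj z)), conj_sFun])
      rw [Complex.conj_im, RCLike.norm_conj, neg_sq] at this
      rwa [abs_of_neg h]
    · simp [h]
    · rw [abs_of_pos h]
      exact hmain z ‖q z‖ h (norm_nonneg _) (by rw [← norm_mul, hqF]; exact (hC z h).1)
  -- On `|z| = 2R` with `R ≥ 1`, `(1 + 2R)² ≤ 9R²`, so `|q| (Im z)² = O(R^(5/2))` and hence `q =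
  -- O(√R)` on the disc of radius `R`: Liouville applies.
  have hconst : ∀ z, q z = q 0 := by
    intro z
    refine eq_of_norm_le_sqrt hq (C := 2 * (A * C * 9 * Real.sqrt 2)) (fun R hR z hzR => ?_) z 0
    have hR0 : 0 < R := by linarith
    refine (norm_le_of_norm_mul_im_sq_le hq hR0
      (M := A * C * 9 * Real.sqrt 2 * Real.sqrt R * R ^ 2) (fun z hz => ?_) hzR).trans
      (le_of_eq (by field_simp))
    refine (hqb z).trans ?_
    rw [hz, Real.sqrt_mul (by norm_num)]
    have : (1 + 2 * R) ^ 2 ≤ 9 * R ^ 2 := by nlinarith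
    calc A * C * (1 + 2 * R) ^ 2 * (Real.sqrt 2 * Real.sqrt R)
        ≤ A * C * (9 * R ^ 2) * (Real.sqrt 2 * Real.sqrt R) := by gcongr
      _ = _ := by ring
  suffices hq0 : q 0 = 0 by rw [← hqF, hconst, hq0, zero_mul]
  by_contra hq0
  have hq0' := norm_pos_iff.2 hq0
  set B := 3 * ‖toL2 he hr ⟨_, h0⟩‖
  have hsin := Real.sin_pos_of_mem_Ioo hβ
  -- If `q` were a nonzero constant, `s_β` would inherit the bound of `F`. With the bound for `s_0`,
  -- `sFun_eq` would give it for `sin β · e`, so `√y` would be bounded along the imaginary axis.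
  have hle : ∀ y : ℝ, 0 < y → Real.sin β * Real.sqrt y ≤ B + C / ‖q 0‖ := by
    intro y hy
    have him : 0 < ((y : ℂ) * Complex.I).im := by simpa using hy
    set z := (y : ℂ) * Complex.I
    have hzy : z.im = y := by simp [z]
    have hez := norm_pos_iff.2 (he.ne_zero hr him.le)
    have h1 := (norm_mul_sqrt_le he hr ⟨_, h0⟩ him).1
    have h2 := (hC z him).1
    rw [← hqF, hconst, norm_mul] at h2
    have h3 : ‖(Real.sin β : ℂ) * e z‖ ≤ ‖sFun e 0 z‖ + ‖sFun e β z‖ := by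
      have : (Real.sin β : ℂ) * e z =
          Complex.exp (-(Complex.I * β)) * sFun e 0 z - sFun e β z := by rw [sFun_eq e β]; ring
      rw [this]
      refine (norm_sub_le _ _).trans ?_
      rw [norm_mul, norm_exp_neg_I_mul, one_mul]
    rw [norm_mul, Complex.norm_real, Real.norm_of_nonneg hsin.le] at h3
    rw [hzy] at h1 h2
    have h4 : ‖sFun e β z‖ * Real.sqrt y ≤ C / ‖q 0‖ * ‖e z‖ := by
      rw [div_mul_eq_mul_div, le_div_iff₀ hq0']
      linarith
    refine le_of_mul_le_mul_right ?_ hez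
    have h5 := mul_le_mul_of_nonneg_right h3 (Real.sqrt_nonneg y)
    simp only [B]
    simp only at h1
    linarith
  obtain ⟨y, hy1, hy2⟩ := ((tendsto_atTop.1 Real.tendsto_sqrt_atTop
    ((B + C / ‖q 0‖ + 1) / Real.sin β)).and (eventually_gt_atTop 0)).exists
  rw [div_le_iff₀ hsin] at hy1
  linarith [hle y hy2]

/-! ### The spectrum of `S_β` -/

theorem exists_eq_of_mem_canonicalExtension {e : ℂ → ℂ} {β : ℝ}
    {p : deBrangesSpace e × deBrangesSpace e} (hp : p ∈ canonicalExtension e β) :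
    ∃ c : ℂ, ∀ z, (p.2 : ℂ → ℂ) z = z * (p.1 : ℂ → ℂ) z + c * sFun e β z := by
  obtain ⟨f, w, -, h⟩ := hp
  exact ⟨_, h⟩

/-- The preimage is `(h - (h(w)/s_β(w)) s_β)/(z - w)`, produced by the parameter `f = (sin β /
s_β(w)) h`. -/
theorem exists_mem_canonicalExtension {e : ℂ → ℂ} (he : IsHermiteBiehler e)
    (hr : ∀ x : ℝ, e x ≠ 0) {β : ℝ} (hβ : β ∈ Set.Ioo 0 Real.pi) {w : ℂ} (hw : sFun e β w ≠ 0)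
    (h : deBrangesSpace e) : ∃ g : deBrangesSpace e, (g, h + w • g) ∈ canonicalExtension e β := by
  have hsin := sin_ne_zero_of_mem hβ
  have hPw : (h : ℂ → ℂ) w + -((h : ℂ → ℂ) w / sFun e β w) * sFun e β w = 0 := by
    field_simp
    ring
  refine ⟨⟨_, dslope_mem he hr h.2 _ β hPw⟩, ((Real.sin β : ℂ) / sFun e β w) • h, w,
    fun z hz => ?_, fun z => ?_⟩
  · have hzw : z - w ≠ 0 := sub_ne_zero.2 hz
    have := sub_mul_dslope (P := fun z => (h : ℂ → ℂ) z + -((h : ℂ → ℂ) w / sFun e β w) *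
      sFun e β z) hPw z
    rw [eq_div_iff (mul_ne_zero hsin hzw), mul_comm, mul_assoc, this]
    simp only [Submodule.coe_smul, Pi.smul_apply, smul_eq_mul]
    field_simp
    ring
  · have := sub_mul_dslope (P := fun z => (h : ℂ → ℂ) z + -((h : ℂ → ℂ) w / sFun e β w) *
      sFun e β z) hPw z
    simp only [Submodule.coe_add, Submodule.coe_smul, Pi.add_apply, Pi.smul_apply, smul_eq_mul]
    have h2 : 1 / (Real.sin β : ℂ) * ((Real.sin β : ℂ) / sFun e β w * (h : ℂ → ℂ) w) *
        sFun e β z = (h : ℂ → ℂ) w / sFun e β w * sFun e β z := by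
      field_simp
    rw [h2]
    linear_combination -this

/-- Evaluation at `w` gives `c = h(w)/s_β(w)`, controlled by the norm of `h`. Far from `w`, division
by `z - w` is harmless; near `w`, a Schwarz-type estimate on the disc of radius 2 bounds the
quotient. -/
theorem exists_norm_toL2_le_of_sub_mul_eq {e : ℂ → ℂ} (he : IsHermiteBiehler e)
    (hr : ∀ x : ℝ, e x ≠ 0) {β : ℝ} {w : ℂ} (hw : sFun e β w ≠ 0) :
    ∃ C : ℝ, 0 ≤ C ∧ ∀ (g h : deBrangesSpace e) (c : ℂ),
      (∀ z, (z - w) * (g : ℂ → ℂ) z = (h : ℂ → ℂ) z - c * sFun e β z) →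
      ‖toL2 he hr g‖ ≤ C * ‖toL2 he hr h‖ := by
  obtain ⟨A, hA0, hA⟩ := exists_norm_le_toL2 he hr (R := ‖w‖ + 2) (by positivity)
  obtain ⟨S, hS⟩ := (isCompact_closedBall (0 : ℂ) (‖w‖ + 2)).exists_bound_of_continuousOn
    (differentiable_sFun he.1 β).continuous.continuousOn
  have hS0 : 0 ≤ S := (norm_nonneg _).trans (hS w (by simp))
  obtain ⟨E, hE⟩ := ((isCompact_closedBall w 1).inter_right
    (isClosed_le continuous_const Complex.continuous_im)).exists_bound_of_continuousOn
    ((continuousOn_div_hermiteBiehler he hr (f := fun _ => 1) (differentiable_const _)).mono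
      Set.inter_subset_right)
  set s := ‖sFun e β w‖
  have hs : 0 < s := norm_pos_iff.2 hw
  set B := A + A / s * S
  set M := B / 2 * |E|
  set K := 2 + (4 * (A / s) ^ 2 + 2 * M ^ 2) * Real.pi
  have hK : 0 ≤ K := by positivity
  refine ⟨Real.sqrt K, Real.sqrt_nonneg _, fun g h c hg => ?_⟩
  set N := ‖toL2 he hr h‖
  have hN : 0 ≤ N := norm_nonneg _
  set P : ℂ → ℂ := fun z => (h : ℂ → ℂ) z - c * sFun e β z
  have hPd : Differentiable ℂ P := h.2.1.sub ((differentiable_sFun he.1 β).const_mul c)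
  have hPw : P w = 0 := by
    change (h : ℂ → ℂ) w - c * sFun e β w = 0
    rw [← hg, sub_self, zero_mul]
  have hc : ‖c‖ ≤ A / s * N := by
    have h1 : (h : ℂ → ℂ) w = c * sFun e β w := sub_eq_zero.1 hPw
    have h2 := hA h w (by linarith)
    rw [h1, norm_mul] at h2
    rw [div_mul_eq_mul_div, le_div_iff₀ hs]
    exact h2
  have hPle : ∀ z : ℂ, ‖z‖ ≤ ‖w‖ + 2 → ‖P z‖ ≤ B * N := by
    intro z hz
    have h1 := hS z (by simpa using hz)
    calc ‖P z‖ ≤ ‖(h : ℂ → ℂ) z‖ + ‖c‖ * ‖sFun e β z‖ := by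
          rw [← norm_mul]; exact norm_sub_le _ _
      _ ≤ A * N + A / s * N * S := add_le_add (hA h z hz)
          (mul_le_mul hc h1 (norm_nonneg _) (by positivity))
      _ = B * N := by simp only [B]; ring
  have hgd : (g : ℂ → ℂ) = dslope P w :=
    eq_dslope_of_forall_ne hPd g.2.1.continuous fun z _ => hg z
  have hgle : ∀ z ∈ Metric.ball w 2, ‖(g : ℂ → ℂ) z‖ ≤ B * N / 2 := by
    intro z hz
    rw [hgd]
    refine Complex.norm_dslope_le_div_of_mapsTo_ball hPd.differentiableOn (fun v hv => ?_) hz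
    rw [hPw, mem_closedBall_zero_iff]
    refine hPle v ?_
    have h1 : ‖v - w‖ < 2 := by simpa [dist_eq_norm] using hv
    have h2 := norm_add_le (v - w) w
    rw [sub_add_cancel] at h2
    linarith
  have hline : lineSq (fun z => (g : ℂ → ℂ) z / e z) 0 ≤ ENNReal.ofReal (K * N ^ 2) := by
    rw [lineSq_zero_eq]
    refine (lintegral_sq_le_of_forall_le (G := fun x : ℝ => (h : ℂ → ℂ) x / e x) (u := w.re)
      (c := 4 * (A / s * N) ^ 2 + 2 * (M * N) ^ 2) (by positivity) fun x => ?_).trans ?_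
    · have hex := norm_pos_iff.2 (hr x)
      have hx : (x : ℂ) + ((0 : ℝ) : ℂ) * Complex.I = x := by simp
      refine sq_le_of_mul_norm_sub_le (y := 0) (norm_nonneg _) (fun hxw => ?_) ?_
      · rw [hx] at hxw
        have h1 := hgle x (by
          rw [Metric.mem_ball, dist_eq_norm]; linarith)
        have h2 := hE x ⟨by simpa [dist_eq_norm] using hxw, by simp⟩
        rw [norm_div, norm_one] at h2
        rw [norm_div, div_eq_mul_one_div]
        calc ‖(g : ℂ → ℂ) x‖ * (1 / ‖e x‖) ≤ (B * N / 2) * |E| :=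
              mul_le_mul h1 (h2.trans (le_abs_self _)) (by positivity) (by positivity)
          _ = M * N := by simp only [M]; ring
      · rw [hx, norm_div, norm_div, div_mul_eq_mul_div, ← norm_mul, mul_comm ((g : ℂ → ℂ) x), hg,
          div_add' _ _ _ hex.ne']
        gcongr
        refine (norm_sub_le _ _).trans ?_
        rw [norm_mul]
        have := he.norm_sFun_le β (z := x) (by simp)
        gcongr
    · rw [← lineSq_zero_eq (fun z => (h : ℂ → ℂ) z / e z), lineSq_eq_norm_toL2 he hr,
        show (2 : ℝ≥0∞) * ENNReal.ofReal (‖toL2 he hr h‖ ^ 2) = ENNReal.ofReal 2 *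
          ENNReal.ofReal (‖toL2 he hr h‖ ^ 2) by simp, ← ENNReal.ofReal_mul (by norm_num),
        ← ENNReal.ofReal_add (by positivity) (by positivity)]
      refine ENNReal.ofReal_le_ofReal (le_of_eq ?_)
      simp only [K, N]
      ring
  rw [lineSq_eq_norm_toL2 he hr, ENNReal.ofReal_le_ofReal_iff (by positivity)] at hline
  refine le_of_sq_le_sq ?_ (by positivity)
  rwa [mul_pow, Real.sq_sqrt hK]

theorem mem_specExtension_iff {e : ℂ → ℂ} (he : IsHermiteBiehler e) (hr : ∀ x : ℝ, e x ≠ 0)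
    {β : ℝ} (hβ : β ∈ Set.Ioo 0 Real.pi) (h0 : sFun e 0 ∈ deBrangesSpace e) (w : ℂ) :
    w ∈ specExtension e β ↔ sFun e β w = 0 := by
  have hsin := sin_ne_zero_of_mem hβ
  constructor
  · contrapose!
    intro hw hmem
    refine hmem ⟨fun h => ?_, ?_⟩
    · obtain ⟨g, hg⟩ := exists_mem_canonicalExtension he hr hβ hw h
      refine ⟨g, hg, fun g' hg' => ?_⟩
      obtain ⟨c, hc⟩ := exists_eq_of_mem_canonicalExtension hg
      obtain ⟨c', hc'⟩ := exists_eq_of_mem_canonicalExtension hg'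
      simp only [Submodule.coe_add, Submodule.coe_smul, Pi.add_apply, Pi.smul_apply,
        smul_eq_mul] at hc hc'
      -- At `z = w` the terms in `g` and `g'` cancel, leaving `h(w) = c s_β(w) = c' s_β(w)`.
      have hcc : c' = c := mul_right_cancel₀ hw (by linear_combination hc w - hc' w)
      refine Subtype.ext (Continuous.ext_on (dense_compl_singleton w) g'.2.1.continuous
        g.2.1.continuous fun z hz => mul_left_cancel₀ (sub_ne_zero.2 hz) ?_)
      rw [hcc] at hc'
      linear_combination hc z - hc' z
    · obtain ⟨C, hC0, hC⟩ := exists_norm_toL2_le_of_sub_mul_eq he hr hw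
      refine ⟨Real.toNNReal C, fun p hp => ?_⟩
      obtain ⟨c, hc⟩ := exists_eq_of_mem_canonicalExtension hp
      have h1 := hC p.1 (p.2 - w • p.1) c fun z => by
        simp only [Submodule.coe_sub, Submodule.coe_smul, Pi.sub_apply, Pi.smul_apply, smul_eq_mul]
        linear_combination -hc z
      rw [deBrangesNorm_eq he hr, deBrangesNorm_eq he hr]
      refine le_trans ?_ (ENNReal.ofReal_mul hC0).le
      exact ENNReal.ofReal_le_ofReal h1
  · intro hw hmem
    set k := sKernel he hr hw
    have hzero : ((0 : deBrangesSpace e), (0 : deBrangesSpace e) + w • 0) ∈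
        canonicalExtension e β :=
      ⟨0, w, fun z _ => by simp, fun z => by simp⟩
    have hs0 := sFun_zero_ne_zero he hr hβ hw
    -- The parameter is `s_0` scaled so that its value at `w` is `-sin β`. Then `k` is an
    -- eigenvector, and `0` has the two preimages `k` and `0` under `S_β - w`.
    have hk : (k, (0 : deBrangesSpace e) + w • k) ∈ canonicalExtension e β := by
      have hval : ((-((Real.sin β : ℂ) / sFun e 0 w) • (⟨_, h0⟩ : deBrangesSpace e) :
          deBrangesSpace e) : ℂ → ℂ) w = -(Real.sin β : ℂ) := by
        simp only [Submodule.coe_smul, Pi.smul_apply, smul_eq_mul]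
        field_simp
      refine ⟨-((Real.sin β : ℂ) / sFun e 0 w) • ⟨_, h0⟩, w, fun z hz => ?_, fun z => ?_⟩
      · rw [hval, hw, zero_mul, eq_div_iff (mul_ne_zero hsin (sub_ne_zero.2 hz))]
        linear_combination (Real.sin β : ℂ) * sub_mul_sKernel he hr hw z
      · rw [hval]
        simp only [zero_add, Submodule.coe_smul, Pi.smul_apply, smul_eq_mul]
        have : 1 / (Real.sin β : ℂ) * -(Real.sin β : ℂ) = -1 := by field_simp
        rw [this]
        linear_combination -sub_mul_sKernel he hr hw z
    have := (hmem.1 0).unique hk hzero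
    exact toL2_sKernel_ne_zero he hr hw (by rw [show sKernel he hr hw = 0 from this, map_zero])

/-! ### Orthogonal series and limits -/

theorem norm_sq_sum_of_pairwise_inner_eq_zero {E : Type*} [NormedAddCommGroup E]
    [InnerProductSpace ℂ E] {W : ℕ → E} (hW : ∀ i j, i ≠ j → inner ℂ (W i) (W j) = 0)
    (s : Finset ℕ) : ‖∑ k ∈ s, W k‖ ^ 2 = ∑ k ∈ s, ‖W k‖ ^ 2 := by
  induction s using Finset.induction_on with
  | empty => simp
  | insert a s ha ih =>
    have h : inner ℂ (W a) (∑ k ∈ s, W k) = 0 := by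
      rw [inner_sum]
      exact Finset.sum_eq_zero fun k hk => hW a k fun h => ha (h ▸ hk)
    rw [Finset.sum_insert ha, Finset.sum_insert ha, norm_add_sq (𝕜 := ℂ), h, ih]
    simp

theorem cauchySeq_sum_of_pairwise_inner_eq_zero {E : Type*} [NormedAddCommGroup E]
    [InnerProductSpace ℂ E] {W : ℕ → E} (hW : ∀ i j, i ≠ j → inner ℂ (W i) (W j) = 0)
    (hs : Summable fun k => ‖W k‖ ^ 2) : CauchySeq fun n => ∑ k ∈ Finset.range n, W k := by
  have hA := hs.hasSum.tendsto_sum_nat.cauchySeq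
  rw [Metric.cauchySeq_iff'] at hA ⊢
  intro ε hε
  obtain ⟨N, hN⟩ := hA (ε ^ 2) (by positivity)
  refine ⟨N, fun n hn => ?_⟩
  have h1 := hN n hn
  rw [Real.dist_eq, ← Finset.sum_Ico_eq_sub _ hn] at h1
  rw [dist_eq_norm, ← Finset.sum_Ico_eq_sub _ hn]
  refine lt_of_pow_lt_pow_left₀ 2 hε.le ?_
  rw [norm_sq_sum_of_pairwise_inner_eq_zero hW]
  exact (le_abs_self _).trans_lt h1

/-- Bounded point evaluations turn `L_2` convergence into locally uniform convergence. The pointwise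
bounds pass to the limit, and they are all that `eq_zero_of_vanishing_on_zeros` requires. -/
theorem exists_entire_limit {e : ℂ → ℂ} (he : IsHermiteBiehler e) (hr : ∀ x : ℝ, e x ≠ 0)
    {S : ℕ → deBrangesSpace e} (hS : CauchySeq fun n => toL2 he hr (S n)) :
    ∃ F : ℂ → ℂ, Differentiable ℂ F ∧
      (∀ K : Set ℂ, IsCompact K → TendstoUniformlyOn (fun n => (S n : ℂ → ℂ)) F atTop K) ∧
      ∃ C : ℝ, ∀ z : ℂ, 0 < z.im → ‖F z‖ * Real.sqrt z.im ≤ C * ‖e z‖ ∧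
        ‖F (conj z)‖ * Real.sqrt z.im ≤ C * ‖e z‖ := by
  have hunif : ∀ K : Set ℂ, IsCompact K →
      UniformCauchySeqOn (fun n => (S n : ℂ → ℂ)) atTop K := by
    intro K hK
    obtain ⟨R, hR⟩ := hK.isBounded.subset_closedBall (0 : ℂ)
    obtain ⟨A, hA0, hA⟩ := exists_norm_le_toL2 he hr (R := max R 1) (by positivity)
    rw [Metric.uniformCauchySeqOn_iff]
    intro ε hε
    obtain ⟨N, hN⟩ := Metric.cauchySeq_iff.1 hS (ε / (A + 1)) (by positivity)
    refine ⟨N, fun m hm n hn z hz => ?_⟩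
    have h1 := hN m hm n hn
    rw [dist_eq_norm, ← map_sub, lt_div_iff₀ (by positivity)] at h1
    have h2 := hA (S m - S n) z ((by simpa using hR hz : ‖z‖ ≤ R).trans (le_max_left _ _))
    rw [Submodule.coe_sub, Pi.sub_apply] at h2
    rw [dist_eq_norm]
    nlinarith [norm_nonneg (toL2 he hr (S m - S n))]
  have hlim : ∀ z : ℂ, ∃ a, Tendsto (fun n => (S n : ℂ → ℂ) z) atTop (𝓝 a) := fun z =>
    cauchySeq_tendsto_of_complete
      ((hunif {z} isCompact_singleton).cauchySeq (Set.mem_singleton z))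
  choose F hF using hlim
  have hT : ∀ K : Set ℂ, IsCompact K → TendstoUniformlyOn (fun n => (S n : ℂ → ℂ)) F atTop K :=
    fun K hK => (hunif K hK).tendstoUniformlyOn_of_tendsto fun z _ => hF z
  refine ⟨F, ?_, hT, ?_⟩
  · have hloc : TendstoLocallyUniformlyOn (fun n => (S n : ℂ → ℂ)) F atTop Set.univ :=
      (tendstoLocallyUniformlyOn_iff_forall_isCompact isOpen_univ).2 fun K _ hK => hT K hK
    exact differentiableOn_univ.1 (hloc.differentiableOn
      (Eventually.of_forall fun n => (S n).2.1.differentiableOn) isOpen_univ)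
  · obtain ⟨M, hM⟩ := hS.norm_bddAbove
    refine ⟨3 * M, fun z hz => ?_⟩
    have hle : ∀ n, 3 * ‖toL2 he hr (S n)‖ * ‖e z‖ ≤ 3 * M * ‖e z‖ := fun n => by
      have : ‖toL2 he hr (S n)‖ ≤ M := hM ⟨n, rfl⟩
      gcongr
    exact ⟨le_of_tendsto' ((hF z).norm.mul_const _) fun n =>
        (norm_mul_sqrt_le he hr (S n) hz).1.trans (hle n),
      le_of_tendsto' ((hF _).norm.mul_const _) fun n =>
        (norm_mul_sqrt_le he hr (S n) hz).2.trans (hle n)⟩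

/-- Fatou's lemma on each horizontal line, where the norms are controlled by the boundary norms. -/
theorem memHardyTwo_of_tendsto {e g : ℂ → ℂ} (he : IsHermiteBiehler e) (hr : ∀ x : ℝ, e x ≠ 0)
    (hg : Differentiable ℂ g) {S : ℕ → ℂ → ℂ} (hS : ∀ n, Differentiable ℂ (S n))
    (hSH : ∀ n, MemHardyTwo fun z => S n z / e z) {M : ℝ≥0}
    (hM : ∀ n, lineSq (fun z => S n z / e z) 0 ≤ M)
    (hlim : ∀ z : ℂ, 0 < z.im → Tendsto (fun n => S n z) atTop (𝓝 (g z))) :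
    MemHardyTwo fun z => g z / e z := by
  refine ⟨differentiableOn_div_hermiteBiehler he hg, M, fun y hy => ?_⟩
  have hl : ∀ x : ℝ, Tendsto (fun n => ‖S n ((x : ℂ) + (y : ℂ) * Complex.I) /
      e ((x : ℂ) + (y : ℂ) * Complex.I)‖ₑ ^ 2) atTop
      (𝓝 (‖g ((x : ℂ) + (y : ℂ) * Complex.I) / e ((x : ℂ) + (y : ℂ) * Complex.I)‖ₑ ^ 2)) :=
    fun x => ((ENNReal.continuous_pow 2).comp continuous_enorm).continuousAt.tendsto.comp
      ((hlim _ (by rw [im_line]; exact hy)).div_const _)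
  calc _ = ∫⁻ x : ℝ, liminf (fun n => ‖S n ((x : ℂ) + (y : ℂ) * Complex.I) /
        e ((x : ℂ) + (y : ℂ) * Complex.I)‖ₑ ^ 2) atTop :=
        lintegral_congr fun x => (hl x).liminf_eq.symm
    _ ≤ liminf (fun n => lineSq (fun z => S n z / e z) y) atTop := by
      refine lintegral_liminf_le fun n => ?_
      exact (continuous_line (continuousOn_div_hermiteBiehler he hr (hS n))
        hy.le).measurable.enorm.pow_const 2
    _ ≤ M := by
      refine liminf_le_of_le (by isBoundedDefault) fun b hb => ?_
      obtain ⟨n, hn⟩ := hb.exists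
      exact hn.trans ((lineSq_le_lineSq_zero (continuousOn_div_hermiteBiehler he hr (hS n))
        (hSH n) hy.le).trans (hM n))

theorem mem_deBrangesSpace_of_tendsto {e g : ℂ → ℂ} (he : IsHermiteBiehler e)
    (hr : ∀ x : ℝ, e x ≠ 0) (hg : Differentiable ℂ g) {S : ℕ → deBrangesSpace e} {M : ℝ}
    (hM : ∀ n, ‖toL2 he hr (S n)‖ ^ 2 ≤ M)
    (hlim : ∀ z : ℂ, z.im ≠ 0 → Tendsto (fun n => (S n : ℂ → ℂ) z) atTop (𝓝 (g z))) :
    g ∈ deBrangesSpace e := by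
  have hb : ∀ n, lineSq (fun z => (S n : ℂ → ℂ) z / e z) 0 ≤ (Real.toNNReal M : ℝ≥0∞) := fun n => by
    rw [lineSq_eq_norm_toL2 he hr]
    exact ENNReal.ofReal_le_ofReal (hM n)
  refine ⟨hg, ?_, ?_⟩
  · exact memHardyTwo_of_tendsto he hr hg (fun n => (S n).2.1) (fun n => (S n).2.2.1) hb
      fun z hz => hlim z hz.ne'
  · refine memHardyTwo_of_tendsto he hr (differentiable_sharp hg)
      (fun n => differentiable_sharp (S n).2.1) (fun n => (S n).2.2.2)
      (fun n => (lineSq_sharp_zero e _).trans_le (hb n)) fun z hz => ?_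
    exact (Complex.continuous_conj.tendsto _).comp (hlim (conj z) (by simpa using hz.ne'))

/-- Bessel's inequality for the normalised vectors. -/
theorem summable_norm_sq_smul_of_inner_eq {E ι : Type*} [NormedAddCommGroup E]
    [InnerProductSpace ℂ E] {v : ι → E} {a : ι → ℂ} {y : E}
    (hv : ∀ i k, i ≠ k → inner ℂ (v i) (v k) = 0) (hv0 : ∀ k, v k ≠ 0)
    (ha : ∀ k, inner ℂ (v k) y = a k * (‖v k‖ : ℂ) ^ 2) :
    Summable fun k => ‖a k • v k‖ ^ 2 := by
  have hn : ∀ k, (‖v k‖ : ℂ) ≠ 0 := fun k => Complex.ofReal_ne_zero.2 (norm_ne_zero_iff.2 (hv0 k))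
  have hon : Orthonormal ℂ fun k => ((‖v k‖ : ℂ)⁻¹) • v k := by
    refine ⟨fun k => ?_, fun i k hik => ?_⟩
    · rw [norm_smul, norm_inv, Complex.norm_real, norm_norm, inv_mul_cancel₀]
      exact norm_ne_zero_iff.2 (hv0 k)
    · change inner ℂ (((‖v i‖ : ℂ)⁻¹) • v i) (((‖v k‖ : ℂ)⁻¹) • v k) = 0
      rw [inner_smul_left, inner_smul_right, hv i k hik, mul_zero, mul_zero]
  refine (hon.inner_products_summable y).congr fun k => ?_
  have h3 : conj ((‖v k‖ : ℂ)⁻¹) * (a k * (‖v k‖ : ℂ) ^ 2) = a k * (‖v k‖ : ℂ) := by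
    have := hn k
    rw [map_inv₀, Complex.conj_ofReal]
    field_simp
  rw [inner_smul_left, ha, h3, norm_mul, norm_smul, Complex.norm_real, norm_norm]

/-! ### Sampling series over the zeros of `s_β` -/

section SamplingSeries

variable {e : ℂ → ℂ} (he : IsHermiteBiehler e) (hr : ∀ x : ℝ, e x ≠ 0) {β : ℝ} {I : Set ℕ}
  {x : ℕ → ℂ} (hx : ∀ k ∈ I, sFun e β (x k) = 0)

open Classical in
/-- The term `c_k s_β(z) / (z - x_k)` of a sampling series indexed by `I`. -/
noncomputable def samplingTerm (c : ℕ → ℂ) (k : ℕ) : deBrangesSpace e :=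
  if h : k ∈ I then c k • sKernel he hr (hx k h) else 0

theorem sub_mul_samplingTerm (c : ℕ → ℂ) {k : ℕ} (hk : k ∈ I) (z : ℂ) :
    (z - x k) * (samplingTerm he hr hx c k : ℂ → ℂ) z = c k * sFun e β z := by
  rw [samplingTerm, dif_pos hk, ← sub_mul_sKernel he hr (hx k hk)]
  simp only [Submodule.coe_smul, Pi.smul_apply, smul_eq_mul]
  ring

theorem samplingTerm_of_notMem (c : ℕ → ℂ) {k : ℕ} (hk : k ∉ I) :
    samplingTerm he hr hx c k = 0 := dif_neg hk

theorem samplingTerm_self (c : ℕ → ℂ) {k : ℕ} (hk : k ∈ I) :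
    (samplingTerm he hr hx c k : ℂ → ℂ) (x k) = c k * deriv (sFun e β) (x k) := by
  rw [samplingTerm, dif_pos hk, ← sKernel_self he hr (hx k hk)]
  simp

theorem samplingTerm_of_ne (c : ℕ → ℂ) (hinj : Set.InjOn x I) {k m : ℕ} (hk : k ∈ I)
    (hmk : m ≠ k) : (samplingTerm he hr hx c m : ℂ → ℂ) (x k) = 0 := by
  by_cases hm : m ∈ I
  · have h := sub_mul_samplingTerm he hr hx c hm (x k)
    rw [hx k hk, mul_zero, mul_eq_zero, sub_eq_zero] at h
    exact h.resolve_left fun h => hmk (hinj hm hk h.symm)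
  · simp [samplingTerm_of_notMem he hr hx c hm]

/-- The bridge between series in the space and the partial fractions of `1/j`. -/
theorem sum_samplingTerm_eq (c : ℕ → ℂ) {z : ℂ} (hz : sFun e β z ≠ 0) (n : ℕ) :
    ((∑ k ∈ Finset.range n, samplingTerm he hr hx c k : deBrangesSpace e) : ℂ → ℂ) z =
      sFun e β z * ∑ k ∈ Finset.range n, I.indicator (fun k => c k / (z - x k)) k := by
  rw [Submodule.coe_sum, Finset.sum_apply, Finset.mul_sum]
  refine Finset.sum_congr rfl fun k _ => ?_
  by_cases hk : k ∈ I
  · have hne : z - x k ≠ 0 := fun h => hz (by rw [sub_eq_zero.1 h]; exact hx k hk)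
    rw [Set.indicator_of_mem hk, mul_div_assoc', eq_div_iff hne, mul_comm,
      sub_mul_samplingTerm he hr hx c hk, mul_comm]
  · simp [samplingTerm_of_notMem he hr hx c hk, hk]

theorem inner_samplingTerm (h0 : sFun e 0 ∈ deBrangesSpace e) (hβ : β ∈ Set.Ioo 0 Real.pi)
    (hinj : Set.InjOn x I) (c : ℕ → ℂ) {i j : ℕ} (hij : i ≠ j) :
    inner ℂ (toL2 he hr (samplingTerm he hr hx c i)) (toL2 he hr (samplingTerm he hr hx c j)) =
      0 := by
  by_cases hi : i ∈ I
  · by_cases hj : j ∈ I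
    · rw [samplingTerm, samplingTerm, dif_pos hi, dif_pos hj, map_smul, map_smul, inner_smul_left,
        inner_smul_right, inner_sKernel_eq_zero he hr h0 hβ (hx i hi) (hx j hj)
        fun h => hij (hinj hi hj h)]
      simp
    · rw [samplingTerm_of_notMem he hr hx c hj, map_zero, inner_zero_right]
  · rw [samplingTerm_of_notMem he hr hx c hi, map_zero, inner_zero_left]

theorem exists_norm_sq_samplingTerm (h0 : sFun e 0 ∈ deBrangesSpace e)
    (hβ : β ∈ Set.Ioo 0 Real.pi) (c : ℕ → ℂ) : ∃ D : ℝ, 0 < D ∧ ∀ k,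
      ‖toL2 he hr (samplingTerm he hr hx c k)‖ ^ 2 =
        D * I.indicator (fun k => ‖c k‖ ^ 2 * ‖deriv (sFun e β) (x k) / sFun e 0 (x k)‖) k := by
  obtain ⟨D, hD, h⟩ := exists_norm_sq_sKernel_eq he hr h0 hβ
  refine ⟨D, hD, fun k => ?_⟩
  by_cases hk : k ∈ I
  · rw [samplingTerm, dif_pos hk, Set.indicator_of_mem hk, map_smul, norm_smul, mul_pow, h]
    ring
  · rw [samplingTerm_of_notMem he hr hx c hk, map_zero, Set.indicator_of_notMem hk]
    simp

/-- Bessel's inequality for the sampling series of an element of the de Branges space. -/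
theorem summable_norm_sq_samplingTerm (h0 : sFun e 0 ∈ deBrangesSpace e)
    (hβ : β ∈ Set.Ioo 0 Real.pi) (hinj : Set.InjOn x I) (g : deBrangesSpace e) {c : ℕ → ℂ}
    (hc : ∀ k ∈ I, c k * deriv (sFun e β) (x k) = (g : ℂ → ℂ) (x k)) :
    Summable fun k => ‖toL2 he hr (samplingTerm he hr hx c k)‖ ^ 2 := by
  have hB := summable_norm_sq_smul_of_inner_eq (ι := I) (a := fun k => c k)
    (v := fun k => toL2 he hr (sKernel he hr (hx k k.2))) (y := toL2 he hr g)
    (fun i k hik => inner_sKernel_eq_zero he hr h0 hβ (hx i i.2) (hx k k.2)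
      fun h => hik (Subtype.ext (hinj i.2 k.2 h)))
    (fun k => toL2_sKernel_ne_zero he hr (hx k k.2)) fun k => by
      refine mul_left_cancel₀ (deriv_sFun_ne_zero he hr h0 hβ (hx k k.2)) ?_
      rw [mul_inner_sKernel he hr (hx k k.2) g, ← hc k k.2, inner_self_eq_norm_sq_to_K]
      exact (mul_assoc _ _ _).trans (mul_left_comm _ _ _)
  have hB' : Summable ((fun k => ‖toL2 he hr (samplingTerm he hr hx c k)‖ ^ 2) ∘
      ((↑) : I → ℕ)) := by
    refine hB.congr fun k => ?_
    simp only [Function.comp]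
    rw [samplingTerm, dif_pos k.2, map_smul]
  refine (summable_subtype_iff_indicator.1 hB').congr fun k => ?_
  by_cases hk : k ∈ I
  · rw [Set.indicator_of_mem hk]
  · rw [Set.indicator_of_notMem hk, samplingTerm_of_notMem he hr hx c hk, map_zero, norm_zero]
    simp

/-- Sampling formula: the partial sums of the sampling series of an element of the de Branges
space converge to it uniformly on compact sets. -/
theorem tendstoUniformlyOn_sum_samplingTerm (h0 : sFun e 0 ∈ deBrangesSpace e)
    (hβ : β ∈ Set.Ioo 0 Real.pi) (hinj : Set.InjOn x I)
    (hsurj : ∀ w, sFun e β w = 0 → ∃ k ∈ I, x k = w) (g : deBrangesSpace e) {c : ℕ → ℂ}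
    (hc : ∀ k ∈ I, c k * deriv (sFun e β) (x k) = (g : ℂ → ℂ) (x k)) {K : Set ℂ}
    (hK : IsCompact K) :
    TendstoUniformlyOn (fun n => ((∑ k ∈ Finset.range n, samplingTerm he hr hx c k :
      deBrangesSpace e) : ℂ → ℂ)) g atTop K := by
  have hCau := cauchySeq_sum_of_pairwise_inner_eq_zero
    (fun i j hij => inner_samplingTerm he hr hx h0 hβ hinj c hij)
    (summable_norm_sq_samplingTerm he hr hx h0 hβ hinj g hc)
  simp_rw [← map_sum] at hCau
  -- Membership of the limit in the space is not needed: its pointwise bounds and its values at the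
  -- zeros already identify it with `g`.
  obtain ⟨F, hFd, hFu, C, hFC⟩ := exists_entire_limit he hr hCau
  suffices hFg : F = g by rw [← hFg]; exact hFu K hK
  have hval : ∀ w, sFun e β w = 0 → F w = (g : ℂ → ℂ) w := by
    intro w hw
    obtain ⟨k, hk, rfl⟩ := hsurj w hw
    refine tendsto_nhds_unique ((hFu {x k} isCompact_singleton).tendsto_at rfl)
      (tendsto_const_nhds.congr' ?_)
    -- At `x k` only the `k`-th term survives, so the partial sums equal `g (x k)` as soon as `n >
    -- k`.
    filter_upwards [eventually_gt_atTop k] with n hn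
    rw [Submodule.coe_sum, Finset.sum_apply, Finset.sum_eq_single_of_mem k (Finset.mem_range.2 hn)
      fun m _ hm => samplingTerm_of_ne he hr hx c hinj hk hm, samplingTerm_self he hr hx c hk,
      hc k hk]
  funext z
  refine sub_eq_zero.1 (eq_zero_of_vanishing_on_zeros he hr h0 hβ (F := fun z => F z -
    (g : ℂ → ℂ) z) (hFd.sub g.2.1) (C := C + 3 * ‖toL2 he hr g‖) (fun z hz => ?_)
    (fun w hw => sub_eq_zero.2 (hval w hw)) z)
  have h1 := hFC z hz
  have h2 := norm_mul_sqrt_le he hr g hz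
  have hs := Real.sqrt_nonneg z.im
  constructor
  · nlinarith [mul_le_mul_of_nonneg_right (norm_sub_le (F z) ((g : ℂ → ℂ) z)) hs]
  · nlinarith [mul_le_mul_of_nonneg_right (norm_sub_le (F (conj z)) ((g : ℂ → ℂ) (conj z))) hs]

end SamplingSeries

/-! ### The main theorem -/

theorem mainTheorem3 (e : ℂ → ℂ) (he : IsHermiteBiehler e) (he_real : ∀ x : ℝ, e x ≠ 0)
    (h0 : sFun e 0 ∈ deBrangesSpace e) (β : ℝ) (hβ : β ∈ Set.Ioo 0 Real.pi)
    (j : ℂ → ℂ) (hj : Differentiable ℂ j) (hj_real : ∀ z : ℂ, conj (j z) = j (conj z))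
    (hj_zero : ∀ z : ℂ, j z = 0 ↔ z ∈ specExtension e β)
    (hj_simple : ∀ z ∈ specExtension e β, deriv j z ≠ 0)
    -- an enumeration of the spectrum, indexed by a finite or infinite set of natural numbers
    (I : Set ℕ) (x : ℕ → ℂ) (hx : Set.BijOn x I (specExtension e β)) :
    -- `g` is the entire function `s_β / j`
    ∃ g : ℂ → ℂ, Differentiable ℂ g ∧ (∀ z : ℂ, g z ≠ 0) ∧
      (∀ z : ℂ, z ∉ specExtension e β → g z = sFun e β z / j z) ∧
      (g ∈ deBrangesSpace e ↔
        ∃ c : ℕ → ℂ,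
          Summable (I.indicator fun k => ‖c k‖ ^ 2 * ‖deriv (sFun e β) (x k) / sFun e 0 (x k)‖) ∧
          ∀ K : Set ℂ, IsCompact K → K ⊆ (specExtension e β)ᶜ →
            TendstoUniformlyOn
              (fun (n : ℕ) (z : ℂ) =>
                ∑ k ∈ Finset.range n, I.indicator (fun k => c k / (z - x k)) k)
              (fun z => 1 / j z) Filter.atTop K) := by
  have hspec := mem_specExtension_iff he he_real hβ h0
  have hsd := differentiable_sFun he.1 β
  have hs' : ∀ w, sFun e β w = 0 → deriv (sFun e β) w ≠ 0 := fun w hw =>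
    deriv_sFun_ne_zero he he_real h0 hβ hw
  obtain ⟨g, hg, hgj⟩ := exists_entire_mul_eq hsd hj fun w hw =>
    ⟨(hspec w).1 ((hj_zero w).1 hw), hj_simple w ((hj_zero w).1 hw)⟩
  have hderiv : ∀ w, sFun e β w = 0 → g w * deriv j w = deriv (sFun e β) w := by
    intro w hw
    have hjw : j w = 0 := (hj_zero w).2 ((hspec w).2 hw)
    have h1 : deriv (fun z => g z * j z) w = deriv (sFun e β) w := by
      rw [show (fun z => g z * j z) = sFun e β from funext hgj]
    rw [← h1, deriv_fun_mul (hg w) (hj w), hjw]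
    ring
  -- A zero of `g` would be a zero of `s_β` at which `s_β' = g j'` vanishes, against simplicity.
  have hgne : ∀ z, g z ≠ 0 := by
    intro z hz
    have hsz : sFun e β z = 0 := by rw [← hgj, hz, zero_mul]
    exact hs' z hsz (by rw [← hderiv z hsz, hz, zero_mul])
  have hjne : ∀ z, z ∉ specExtension e β → j z ≠ 0 := fun z hz h => hz ((hj_zero z).1 h)
  have hsne : ∀ z, z ∉ specExtension e β → sFun e β z ≠ 0 := fun z hz h => hz ((hspec z).2 h)
  have hxz : ∀ k ∈ I, sFun e β (x k) = 0 := fun k hk => (hspec _).1 (hx.mapsTo hk)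
  refine ⟨g, hg, hgne, fun z hz => by rw [eq_div_iff (hjne z hz), hgj], fun hgB => ?_, ?_⟩
  -- The residues of `1/j`; as `s_β' = g j'` at the zeros, they are also the sampling coefficients
  -- `g(x_k)/s_β'(x_k)`.
  · set c : ℕ → ℂ := fun k => 1 / deriv j (x k)
    have hc : ∀ k ∈ I, c k * deriv (sFun e β) (x k) = g (x k) := by
      intro k hk
      have := hj_simple _ (hx.mapsTo hk)
      simp only [c]
      rw [← hderiv _ (hxz k hk)]
      field_simp
    refine ⟨c, ?_, fun K hK hKs => ?_⟩
    · obtain ⟨D, hD, h⟩ := exists_norm_sq_samplingTerm he he_real hxz h0 hβ c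
      have hsum := summable_norm_sq_samplingTerm he he_real hxz h0 hβ hx.injOn ⟨g, hgB⟩ hc
      simp_rw [h] at hsum
      exact (summable_mul_left_iff hD.ne').1 hsum
    · have hT := tendstoUniformlyOn_sum_samplingTerm he he_real hxz h0 hβ hx.injOn
        (fun w hw => hx.surjOn ((hspec w).2 hw)) ⟨g, hgB⟩ hc hK
      -- On a compact set avoiding the spectrum `1/s_β` is bounded, so dividing the sampling series
      -- by `s_β` preserves uniform convergence.
      obtain ⟨M, hM⟩ := hK.exists_bound_of_continuousOn (f := fun z => (sFun e β z)⁻¹)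
        (hsd.continuous.continuousOn.inv₀ fun z hz => hsne z (hKs hz))
      rw [Metric.tendstoUniformlyOn_iff] at hT ⊢
      intro ε hε
      filter_upwards [hT (ε / (|M| + 1)) (by positivity)] with n hn z hz
      have h1 := hn z hz
      have hs := hsne z (hKs hz)
      have hj := hjne z (hKs hz)
      rw [sum_samplingTerm_eq he he_real hxz c hs, dist_eq_norm, lt_div_iff₀ (by positivity)] at h1
      rw [dist_eq_norm]
      set σ := ∑ k ∈ Finset.range n, I.indicator (fun k => c k / (z - x k)) k
      have h2 : 1 / j z - σ = (g z - sFun e β z * σ) * (sFun e β z)⁻¹ := by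
        rw [← hgj z] at hs ⊢
        have := hgne z
        field_simp
      rw [h2, norm_mul]
      have h3 : ‖(sFun e β z)⁻¹‖ ≤ |M| + 1 := (hM z hz).trans ((le_abs_self M).trans (by linarith))
      exact (mul_le_mul_of_nonneg_left h3 (norm_nonneg _)).trans_lt h1
  · rintro ⟨c, hsum, hlim⟩
    obtain ⟨D, hD, h⟩ := exists_norm_sq_samplingTerm he he_real hxz h0 hβ c
    have hsum' : Summable fun k => ‖toL2 he he_real (samplingTerm he he_real hxz c k)‖ ^ 2 := by
      simp_rw [h]
      exact hsum.mul_left D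
    -- By orthogonality the squared norms of the partial sums are bounded by the full sum; off the
    -- real axis, multiplying the expansion of `1/j` by `s_β` identifies their limit as `g`.
    refine mem_deBrangesSpace_of_tendsto he he_real hg
      (S := fun n => ∑ k ∈ Finset.range n, samplingTerm he he_real hxz c k)
      (M := ∑' k, ‖toL2 he he_real (samplingTerm he he_real hxz c k)‖ ^ 2) (fun n => ?_)
      fun z hz => ?_
    · rw [map_sum, norm_sq_sum_of_pairwise_inner_eq_zero
        fun i j hij => inner_samplingTerm he he_real hxz h0 hβ hx.injOn c hij]
      exact hsum'.sum_le_tsum _ fun k _ => by positivity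
    · have hsz : sFun e β z ≠ 0 := he.sFun_ne_zero β hz
      have hzs : z ∉ specExtension e β := fun hmem => hsz ((hspec z).1 hmem)
      have h1 := (hlim {z} isCompact_singleton (Set.singleton_subset_iff.2 hzs)).tendsto_at rfl
      have h2 := h1.const_mul (sFun e β z)
      have h3 : sFun e β z * (1 / j z) = g z := by
        rw [← hgj]
        have := hjne z hzs
        field_simp
      rw [h3] at h2
      refine h2.congr fun n => ?_
      rw [sum_samplingTerm_eq he he_real hxz c hsz]
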